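/- Let $\mathbf S^2=\{x\in\mathbb R^3:|x|=1\}$ with surface measure $\lambda$ (total mass $4\pi$), let $Y_{lm}$ ($l\ge 0$, $|m|\le l$) be the standard orthonormal spherical harmonics, $Q_l(z)=\frac{1}{2^l l!}\frac{d^l}{dz^l}(z^2-1)^l$ the Legendre polynomials, and $\mu_l=l(l+1)$. Let $T=\{T(x):x\in\mathbf S^2\}$ be a real, jointly measurable, zero-mean Gaussian random field which is isotropic: for every $g\in SO(3)$ the fields $x\mapsto T(gx)$ and $T$ have the same law. Let $a_{lm}=\int_{\mathbf S^2}T(x)Y_{lm}^*(x)\,\lambda(dx)$ and let $C_l=\mathbb E|a_{lm}|^2$ be the angular power spectrum of $T$ (by isotropy the value does not depend on $m$; take $m=0$). For every $x\in\mathbf S^2$ let $B^{\Psi,x}_t=B^x_{D^x_t}$, $t\ge 0$, be a subordinate rotational Brownian motion started at $x$: $B^x$ is a Brownian motion on $\mathbf S^2$ started at $x$, with generator the spherical Laplacian $\triangle_{\mathbf S^2}$, and $D^x$ is a subordinator independent of $B^x$ with Laplace exponent $\Psi$, that is $\mathbb E e^{-\mu D^x_t}=e^{-t\Psi(\mu)}$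 for $\mu\ge 0$. Suppose that the field $T$ is independent of the processes $(B^{\Psi,x})_{x}$ (more precisely, $T$ is jointly measurable with respect to a $\sigma$-field on $\Omega$ that is independent of these processes, and the Borel sets of $\mathbf S^2$), and that $B^{\Psi,x}_{t_1}$ and $B^{\Psi,y}_{t_2}$ are independent for all $x\ne y$ and $t_1,t_2>0$. Let $$\mathfrak T^\Psi_t(x)=T\big(B^{\Psi,x}_t\big),\qquad t\ge 0,\ x\in\mathbf S^2$$ (also written $T(B^\Psi_t-x)$). Then for all $x\neq y$ in $\mathbf S^2$ and all $t_1,t_2\in[0,\infty)$ the product $\mathfrak T^\Psi_{t_1}(x)\,\mathfrak T^\Psi_{t_2}(y)$ is integrable and $$\mathbb E\big[\mathfrak T^\Psi_{t_1}(x)\,\mathfrak T^\Psi_{t_2}(y)\big]=\sum_{l=0}^\infty\frac{2l+1}{4\pi}\,C_l\,Q_l(\langle x,y\rangle)\,e^{-(t_1+t_2)\Psi(\mu_l)},$$ the series being absolutely convergent. For infinite times the formula holds in the limit: as $t_1+t_2\to\infty$ the left-hand side converges to the sum of the same series with $e^{-(t_1+t_2)\Psi(\mu_l)}$ replaced by $1$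 if $\Psi(\mu_l)=0$ and by $0$ otherwise (so to $C_0/4\pi$ unless $\Psi\equiv 0$). -/

import Mathlib

open MeasureTheory ProbabilityTheory Filter Topology InnerProductSpace
open scoped NNReal

/-- Euclidean three-space. -/
abbrev E3 : Type := EuclideanSpace ℝ (Fin 3)

/-- The unit sphere `{x ∈ ℝ³ : |x| = 1}`. -/
abbrev S2 : Type := Metric.sphere (0 : E3) 1

noncomputable section

/-- The Lebesgue (surface) measure on the unit sphere, of total mass `4π`. -/
def sphereMeasure : Measure S2 := (volume : Measure E3).toSphere

/-! ### Legendre polynomials and spherical harmonics -/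

/-- Legendre polynomials, through Rodrigues' formula
`Q_l(z) = 1 / (2^l l!) d^l/dz^l (z² - 1)^l`. -/
def legendreQ (l : ℕ) : Polynomial ℝ :=
  Polynomial.C (1 / (2 ^ l * (l.factorial : ℝ))) *
    (Polynomial.derivative^[l] ((Polynomial.X ^ 2 - 1) ^ l))

/-- Associated Legendre functions
`Q_{lm}(z) = (-1)^m (1 - z²)^{m/2} d^m/dz^m Q_l(z)`, for `m ≥ 0` and `z ∈ [-1, 1]`. -/
def assocLegendreQ (l m : ℕ) (z : ℝ) : ℝ :=
  (-1) ^ m * (Real.sqrt (1 - z ^ 2)) ^ m * (Polynomial.derivative^[m] (legendreQ l)).eval z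

/-- The longitude `φ` of `x = (sin ϑ cos φ, sin ϑ sin φ, cos ϑ)`. -/
def longitude (x : S2) : ℝ := Complex.arg ⟨(x : E3) 0, (x : E3) 1⟩

/-- The spherical harmonic `Y_{lm}` for `0 ≤ m ≤ l`; here `cos ϑ` is the last coordinate of `x`. -/
def sphericalHarmonicNat (l m : ℕ) (x : S2) : ℂ :=
  ((Real.sqrt ((2 * l + 1) / (4 * Real.pi) *
      (((l - m).factorial : ℝ) / ((l + m).factorial : ℝ))) *
      assocLegendreQ l m ((x : E3) 2) : ℝ) : ℂ) *
    Complex.exp (Complex.I * m * (longitude x : ℂ))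

/-- The spherical harmonics `Y_{lm}`, `-l ≤ m ≤ l`; those with `m < 0` are given by
`Y_{l,-m} = (-1)^m Y_{lm}^*`. -/
def sphericalHarmonic (l : ℕ) (m : ℤ) (x : S2) : ℂ :=
  if 0 ≤ m then sphericalHarmonicNat l m.natAbs x
  else (-1) ^ m.natAbs * (starRingEnd ℂ) (sphericalHarmonicNat l m.natAbs x)

/-! ### Random fields on the sphere -/

/-- The image of a point of the sphere under a linear isometry of `ℝ³`. -/
def rotate (g : E3 ≃ₗᵢ[ℝ] E3) (x : S2) : S2 :=
  ⟨g (x : E3), by simp⟩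

/-- Zero-mean isotropic Gaussian random fields on the sphere: all finite-dimensional laws are
Gaussian, the mean is zero, and for every `g ∈ SO(3)` the fields `x ↦ T (g x)` and `T` have
the same law as processes. -/
structure IsIsotropicGaussianField {Ω : Type*} [MeasurableSpace Ω]
    (T : S2 → Ω → ℝ) (P : Measure Ω) : Prop where
  gaussian : IsGaussianProcess T P
  mean_zero : ∀ x, ∫ ω, T x ω ∂P = 0
  isotropic : ∀ g : E3 ≃ₗᵢ[ℝ] E3, LinearMap.det (g.toLinearEquiv : E3 →ₗ[ℝ] E3) = 1 →
    IdentDistrib (fun ω x => T (rotate g x) ω) (fun ω x => T x ω) P P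

/-- The Fourier random coefficients `a_{lm} = ∫ T(x) Y_{lm}^*(x) λ(dx)`. -/
def randomFourierCoeff {Ω : Type*} (T : S2 → Ω → ℝ) (l : ℕ) (m : ℤ) (ω : Ω) : ℂ :=
  ∫ x, (T x ω : ℂ) * (starRingEnd ℂ) (sphericalHarmonic l m x) ∂sphereMeasure

/-- The angular power spectrum `C_l = E |a_{lm}|²`. For an isotropic field the value does not
depend on `m`, `-l ≤ m ≤ l`; it is taken at `m = 0`. -/
def angularPowerSpectrum {Ω : Type*} [MeasurableSpace Ω]
    (T : S2 → Ω → ℝ) (P : Measure Ω) (l : ℕ) : ℝ :=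
  ∫ ω, ‖randomFourierCoeff T l 0 ω‖ ^ 2 ∂P

/-! ### Subordinate rotational Brownian motion -/

/-- The Laplace-Beltrami operator of the unit sphere, applied to the restriction to the sphere of
a function `F` on `ℝ³`: the Euclidean Laplacian, at points of the sphere, of the extension of
that restriction which is constant along rays. -/
def sphericalLaplacian (F : E3 → ℝ) (x : S2) : ℝ :=
  Laplacian.laplacian (fun y : E3 => F (‖y‖⁻¹ • y)) (x : E3)

/-- `B` is a rotational Brownian motion (Brownian motion on the unit sphere with generator the
spherical Laplacian) started at `x`: it has continuous paths, starts at `x`, and solves the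
martingale problem for the spherical Laplacian, in its natural filtration. The test functions
are the restrictions of smooth functions on `ℝ³`, that is, all smooth functions on the sphere. -/
structure IsRotationalBM {Ω : Type*} [MeasurableSpace Ω]
    (B : ℝ≥0 → Ω → S2) (x : S2) (P : Measure Ω) : Prop where
  measurable : ∀ t, Measurable (B t)
  continuous_paths : ∀ ω, Continuous fun t => B t ω
  start : ∀ᵐ ω ∂P, B 0 ω = x
  martingale : ∀ F : E3 → ℝ, ContDiff ℝ (⊤ : ℕ∞) F →
    Martingale
      (fun (t : ℝ≥0) ω => F (B t ω) - F (B 0 ω) -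
        ∫ s in (0 : ℝ)..t, sphericalLaplacian F (B s.toNNReal ω))
      (Filtration.natural B fun t => (measurable t).stronglyMeasurable) P

/-- `D` is a subordinator: a Lévy process with non-decreasing paths started at zero. -/
structure IsSubordinator {Ω : Type*} [MeasurableSpace Ω]
    (D : ℝ≥0 → Ω → ℝ≥0) (P : Measure Ω) : Prop where
  measurable : ∀ t, Measurable (D t)
  start : ∀ᵐ ω ∂P, D 0 ω = 0
  monotone_paths : ∀ᵐ ω ∂P, Monotone fun t => D t ω
  rightContinuous_paths : ∀ᵐ ω ∂P, ∀ t, ContinuousWithinAt (fun s => D s ω) (Set.Ici t) t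
  indep_increments : HasIndepIncrements (fun t ω => (D t ω : ℝ)) P
  stationary_increments : ∀ s t,
    IdentDistrib (fun ω => (D (s + t) ω : ℝ) - D s ω) (fun ω => (D t ω : ℝ)) P P

/-- `Ψ` is the Laplace exponent of `D`: `E exp(-μ D_t) = exp(-t Ψ(μ))`, for `t, μ ≥ 0`. -/
def HasLaplaceExponent {Ω : Type*} [MeasurableSpace Ω]
    (D : ℝ≥0 → Ω → ℝ≥0) (Ψ : ℝ → ℝ) (P : Measure Ω) : Prop :=
  ∀ (t : ℝ≥0) (μ : ℝ), 0 ≤ μ → ∫ ω, Real.exp (-μ * D t ω) ∂P = Real.exp (-t * Ψ μ)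

/-- The time-changed process `t ↦ B_{D_t}`. -/
def timeChange {Ω : Type*} (B : ℝ≥0 → Ω → S2) (D : ℝ≥0 → Ω → ℝ≥0) : ℝ≥0 → Ω → S2 :=
  fun t ω => B (D t ω) ω

/-- For every starting point `x`, `BΨ x` is a subordinate rotational Brownian motion started
at `x`: it is `B_{D_t}` for a rotational Brownian motion `B` started at `x` and an independent
subordinator `D` with Laplace exponent `Ψ`. -/
def IsSubordinateRotationalBMFamily {Ω : Type*} [MeasurableSpace Ω]
    (BΨ : S2 → ℝ≥0 → Ω → S2) (Ψ : ℝ → ℝ) (P : Measure Ω) : Prop :=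
  ∀ x, ∃ (B : ℝ≥0 → Ω → S2) (D : ℝ≥0 → Ω → ℝ≥0),
    IsRotationalBM B x P ∧ IsSubordinator D P ∧ HasLaplaceExponent D Ψ P ∧
    IndepFun (fun ω t => B t ω) (fun ω t => D t ω) P ∧
    BΨ x = timeChange B D

/-- The field `T` observed at time `t` along the process started at `x`:
`𝔗_t(x) = T(B_t)` with `B_0 = x`. -/
def coordinateChangedField {Ω : Type*} (T : S2 → Ω → ℝ) (BΨ : S2 → ℝ≥0 → Ω → S2)
    (t : ℝ≥0) (x : S2) (ω : Ω) : ℝ :=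
  T (BΨ x t ω) ω

/-- The eigenvalues `μ_l = l (l + 1)` of minus the spherical Laplacian. -/
def sphereEigenvalue (l : ℕ) : ℝ := l * (l + 1)

/-- The coefficient `(2l+1)/(4π) C_l Q_l(⟨x, y⟩)` of the `l`-th frequency component. -/
def frequencyCovariance {Ω : Type*} [MeasurableSpace Ω]
    (T : S2 → Ω → ℝ) (P : Measure Ω) (x y : S2) (l : ℕ) : ℝ :=
  (2 * l + 1) / (4 * Real.pi) * angularPowerSpectrum T P l *
    (legendreQ l).eval (inner ℝ (x : E3) (y : E3))

end

/-! ### Legendre polynomials: differential equation, orthogonality, norms, span. -/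

section Legendre

open Polynomial

/-! Freeze the positions of the two processes. The field is jointly measurable over a σ-field
independent of them, so Fubini turns the expectation into the integral of the covariance
`covarianceKernel`, a function κ of the inner product, against the product of the two position laws
(`integral_field_comp`). Two facts then finish the proof.

First, the zonal function x ↦ Q_l(⟨x, v⟩) is an eigenfunction of the spherical Laplacian for -μ_l.
The martingale problem makes its mean along Brownian motion decay like e^{-μ_l t}, and averaging
over the subordinator replaces this by e^{-tΨ(μ_l)} (`integral_zonal_rotationalBM`,
`integral_zonal_timeChange`). Using this in each variable gives the factor e^{-(t₁+t₂)Ψ(μ_l)}.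

Second, κ has the absolutely convergent expansion Σ (2l+1)/(4π) C_l Q_l (`hasSum_covarianceKernel`).
Continuity of κ is not assumed: joint measurability confines the sections of the field to a
separable L² space, so two distinct points have close values, and isotropy spreads this to all close
pairs (`exists_delta`). By Funk–Hecke, κ acts on Q_l as multiplication by C_l; a Bessel inequality
bounds Σ (2l+1)/(4π) C_l by the variance; and κ minus its series is orthogonal to every Q_l, hence
zero by Weierstrass.

Since |Q_l| ≤ 1 on [-1, 1], the summable variances dominate everything, which justifies both
termwise integration and the limit of infinite times. -/

lemma derivative_rodrigues (l : ℕ) :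
    (X ^ 2 - 1 : ℝ[X]) * derivative ((X ^ 2 - 1 : ℝ[X]) ^ l) = 2 * (l : ℝ[X]) * X * (X ^ 2 - 1) ^ l := by
  rcases l with _ | l
  · simp
  · simp [derivative_pow]
    rw [show (C (2:ℝ) : ℝ[X]) = 2 from rfl]
    ring

/-- Each step of the induction differentiates the relation once more, starting from (X² - 1)u' =
2lXu. At k = l the coefficients collapse to those of Legendre's equation. -/
lemma iterate_derivative_rodrigues (l k : ℕ) :
    (X ^ 2 - 1 : ℝ[X]) * derivative^[k + 2] ((X ^ 2 - 1 : ℝ[X]) ^ l)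
      + (2 * ((k : ℝ[X]) + 1) - 2 * (l : ℝ[X])) * X * derivative^[k + 1] ((X ^ 2 - 1 : ℝ[X]) ^ l)
      + (((k : ℝ[X]) + 1) * (k : ℝ[X]) - 2 * (l : ℝ[X]) * ((k : ℝ[X]) + 1)) * derivative^[k] ((X ^ 2 - 1 : ℝ[X]) ^ l) = 0 := by
  set u : ℝ[X] := (X ^ 2 - 1) ^ l with hu
  induction k with
  | zero =>
    have h := congrArg derivative (derivative_rodrigues l)
    rw [← hu] at h
    have h3 : derivative (X ^ 2 - 1 : ℝ[X]) = 2 * X := by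
      simp; norm_num
    have h4 : derivative (2 * (l : ℝ[X]) * X) = 2 * (l : ℝ[X]) := by
      rw [derivative_mul, derivative_X]; simp
    rw [derivative_mul, derivative_mul, h3, h4] at h
    simp only [Function.iterate_succ_apply', Function.iterate_zero, id]
    push_cast
    linear_combination h
  | succ k ih =>
    have h := congrArg derivative ih
    have h1 : derivative (2 * ((k : ℝ[X]) + 1) - 2 * (l : ℝ[X])) = 0 := by simp
    have h2 : derivative (((k : ℝ[X]) + 1) * (k : ℝ[X]) - 2 * (l : ℝ[X]) * ((k : ℝ[X]) + 1)) = 0 := by simp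
    have h3 : derivative (X ^ 2 - 1 : ℝ[X]) = 2 * X := by
      simp; norm_num
    rw [derivative_add, derivative_add, derivative_mul, derivative_mul, derivative_mul,
      derivative_mul, h1, h2, h3, derivative_X, derivative_zero] at h
    simp only [Function.iterate_succ_apply'] at h ⊢
    push_cast
    linear_combination h

lemma legendreQ_ode (l : ℕ) :
    (1 - X ^ 2) * derivative^[2] (legendreQ l) - 2 * X * derivative (legendreQ l)
      = -C (sphereEigenvalue l) * legendreQ l := by
  have h := iterate_derivative_rodrigues l l
  simp only [Function.iterate_succ_apply', Function.iterate_zero, id] at h ⊢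
  simp only [legendreQ, derivative_C_mul, sphereEigenvalue, C_mul, C_add, C_1, map_natCast]
  linear_combination (-C (1 / (2 ^ l * (l.factorial : ℝ)))) * h

/-- In the Leibniz expansion only the term with all derivatives on the power survives at `s`.
Factoring X² - 1 then gives the values of Q_l at ±1. -/
lemma eval_iterate_derivative_X_sub_C_pow_mul (l : ℕ) (s : ℝ) (q : ℝ[X]) :
    (derivative^[l] ((X - C s) ^ l * q)).eval s = l.factorial * q.eval s := by
  rw [iterate_derivative_mul, eval_finsetSum, Finset.sum_eq_single 0]
  · simp [iterate_derivative_X_sub_pow_self]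
  · intro k hk hk0
    have hkl : l - (l - k) ≠ 0 := by
      have := Finset.mem_range.mp hk
      omega
    simp [iterate_derivative_X_sub_pow, hkl]
  · simp

lemma eval_legendreQ_one (l : ℕ) : (legendreQ l).eval 1 = 1 := by
  have e : (X ^ 2 - 1 : ℝ[X]) ^ l = (X - C 1) ^ l * (X + 1) ^ l := by
    rw [← mul_pow, C_1]; ring
  rw [legendreQ, e, eval_mul, eval_iterate_derivative_X_sub_C_pow_mul]
  have := Nat.cast_ne_zero (R := ℝ).mpr l.factorial_ne_zero
  simp
  norm_num
  field_simp

lemma eval_legendreQ_neg_one_sq (l : ℕ) : (legendreQ l).eval (-1) ^ 2 = 1 := by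
  have e : (X ^ 2 - 1 : ℝ[X]) ^ l = (X - C (-1)) ^ l * (X - 1) ^ l := by
    rw [← mul_pow, C_neg, C_1]; ring
  rw [legendreQ, e, eval_mul, eval_iterate_derivative_X_sub_C_pow_mul]
  have := Nat.cast_ne_zero (R := ℝ).mpr l.factorial_ne_zero
  simp only [eval_C, eval_pow, eval_sub, eval_X, eval_one]
  rw [show (-1 - 1 : ℝ) = -2 by norm_num, mul_pow, mul_pow, ← pow_mul (-2 : ℝ), mul_comm l 2,
    pow_mul (-2 : ℝ)]
  field_simp
  rw [← pow_mul, mul_comm 2 l, pow_mul]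

lemma monic_rodrigues (l : ℕ) : ((X ^ 2 - 1 : ℝ[X]) ^ l).Monic := by
  have := (monic_X_pow_sub_C (1 : ℝ) (two_ne_zero : (2 : ℕ) ≠ 0)).pow l
  rwa [C_1] at this

lemma natDegree_rodrigues (l : ℕ) : ((X ^ 2 - 1 : ℝ[X]) ^ l).natDegree = l * 2 := by
  rw [natDegree_pow, ← C_1, natDegree_X_pow_sub_C]

lemma natDegree_legendreQ_le (l : ℕ) : (legendreQ l).natDegree ≤ l := by
  refine (natDegree_C_mul_le _ _).trans ((natDegree_iterate_derivative _ _).trans ?_)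
  rw [natDegree_rodrigues]
  omega

lemma coeff_legendreQ_ne_zero (l : ℕ) : (legendreQ l).coeff l ≠ 0 := by
  have h : ((X ^ 2 - 1 : ℝ[X]) ^ l).coeff (l + l) = 1 := by
    rw [← mul_two, ← natDegree_rodrigues l]
    exact monic_rodrigues l
  rw [legendreQ, coeff_C_mul, coeff_iterate_derivative, h]
  have h1 : ((l + l).descFactorial l : ℝ) ≠ 0 := by
    rw [Nat.cast_ne_zero, Ne, Nat.descFactorial_eq_zero_iff_lt]; omega
  have := Nat.cast_ne_zero (R := ℝ).mpr l.factorial_ne_zero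
  simp [h1, this]

/-- The integral of a polynomial over `[-1, 1]`. -/
noncomputable def intervalInt (p : ℝ[X]) : ℝ := ∫ t in (-1 : ℝ)..1, p.eval t

lemma intervalInt_add (p q : ℝ[X]) : intervalInt (p + q) = intervalInt p + intervalInt q := by
  simp only [intervalInt, eval_add]
  exact intervalIntegral.integral_add (p.continuous.intervalIntegrable _ _)
    (q.continuous.intervalIntegrable _ _)

lemma intervalInt_C_mul (c : ℝ) (p : ℝ[X]) : intervalInt (C c * p) = c * intervalInt p := by
  simp [intervalInt]

lemma intervalInt_derivative (p : ℝ[X]) :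
    intervalInt (derivative p) = p.eval 1 - p.eval (-1) :=
  intervalIntegral.integral_eq_sub_of_hasDerivAt (fun t _ => p.hasDerivAt t)
    ((derivative p).continuous.intervalIntegrable _ _)

/-- Repeated integration by parts moves the derivatives onto `g`. The boundary terms vanish because
fewer than `l` derivatives of (X² - 1)^l leave a factor X² - 1. -/
lemma intervalInt_iterate_derivative_mul (l : ℕ) : ∀ k ≤ l, ∀ g : ℝ[X], derivative^[k] g = 0 →
    intervalInt (derivative^[k] ((X ^ 2 - 1 : ℝ[X]) ^ l) * g) = 0 := by
  intro k
  induction k with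
  | zero => intro _ g hg; simp at hg; simp [hg, intervalInt]
  | succ k ih =>
    intro hk g hg
    have h0 : ∀ s : ℝ, s ^ 2 = 1 → (derivative^[k] ((X ^ 2 - 1 : ℝ[X]) ^ l)).eval s = 0 := by
      intro s hs
      obtain ⟨r, hr⟩ := pow_sub_dvd_iterate_derivative_pow (X ^ 2 - 1 : ℝ[X]) l k
      rw [hr]
      have : l - k ≠ 0 := by omega
      simp [hs, this]
    have h1 := ih (by omega) (derivative g) (by rwa [← Function.iterate_succ_apply])
    have h2 := intervalInt_derivative (derivative^[k] ((X ^ 2 - 1 : ℝ[X]) ^ l) * g)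
    rw [derivative_mul, intervalInt_add, h1, ← Function.iterate_succ_apply' derivative, eval_mul,
      eval_mul, h0 1 (by norm_num), h0 (-1) (by norm_num)] at h2
    simpa using h2

lemma intervalInt_legendreQ_mul (l : ℕ) (g : ℝ[X]) (hg : derivative^[l] g = 0) :
    intervalInt (legendreQ l * g) = 0 := by
  rw [legendreQ, mul_assoc, intervalInt_C_mul,
    intervalInt_iterate_derivative_mul l l le_rfl g hg, mul_zero]

/-- XQ' - lQ has degree below `l`, hence is orthogonal to Q. So integrating (XQ²)' = 2Q(XQ' - lQ) +
(2l+1)Q² leaves only the last term, against a boundary value of 2. -/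
lemma intervalInt_legendreQ_sq (l : ℕ) :
    intervalInt (legendreQ l * legendreQ l) = 2 / (2 * l + 1) := by
  have h := intervalInt_derivative (X * (legendreQ l * legendreQ l))
  have hd : derivative^[l] (X * derivative (legendreQ l) - C (l : ℝ) * legendreQ l) = 0 := by
    apply iterate_derivative_eq_zero_of_degree_lt
    rw [degree_lt_iff_coeff_zero]
    intro m hm
    have e : (X * derivative (legendreQ l)).coeff m = m * (legendreQ l).coeff m := by
      rcases m with _ | m
      · simp
      · rw [coeff_X_mul, coeff_derivative]; push_cast; ring
    rw [coeff_sub, coeff_C_mul, e]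
    rcases hm.eq_or_lt with rfl | hm
    · simp
    · rw [coeff_eq_zero_of_natDegree_lt ((natDegree_legendreQ_le l).trans_lt hm)]; simp
  have h2 := intervalInt_legendreQ_mul l _ hd
  have e : derivative (X * (legendreQ l * legendreQ l)) =
      C 2 * (legendreQ l * (X * derivative (legendreQ l) - C (l : ℝ) * legendreQ l)) +
      C (2 * (l : ℝ) + 1) * (legendreQ l * legendreQ l) := by
    simp only [derivative_mul, derivative_X, C_add, C_mul, C_1]
    rw [show (C (2:ℝ) : ℝ[X]) = 2 from rfl]
    ring
  rw [e, intervalInt_add, intervalInt_C_mul, intervalInt_C_mul, h2] at h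
  have e1 := eval_legendreQ_one l
  have e2 := eval_legendreQ_neg_one_sq l
  simp only [eval_mul, eval_X, e1] at h
  field_simp
  nlinarith

lemma eq_zero_of_intervalInt_sq {p : ℝ[X]} (h : intervalInt (p * p) = 0) : p = 0 := by
  apply eq_zero_of_infinite_isRoot
  refine (Set.Icc_infinite (show (-1 : ℝ) < 1 by norm_num)).mono fun c hc => ?_
  by_contra hne
  refine (intervalIntegral.integral_pos (show (-1 : ℝ) < 1 by norm_num)
    (p * p).continuous.continuousOn (fun x _ => ?_) ⟨c, hc, ?_⟩).ne' h
  · rw [eval_mul]; exact mul_self_nonneg _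
  · rw [eval_mul]; exact mul_self_pos.mpr hne

lemma degree_sub_C_mul_legendreQ_lt (l : ℕ) (q : ℝ[X]) (hq : q.natDegree ≤ l) :
    (q - C (q.coeff l / (legendreQ l).coeff l) * legendreQ l).degree < l := by
  rw [degree_lt_iff_coeff_zero]
  intro m hm
  rw [coeff_sub, coeff_C_mul]
  rcases hm.eq_or_lt with rfl | hm
  · rw [div_mul_cancel₀ _ (coeff_legendreQ_ne_zero _), sub_self]
  · rw [coeff_eq_zero_of_natDegree_lt ((natDegree_legendreQ_le l).trans_lt hm),
      coeff_eq_zero_of_natDegree_lt (hq.trans_lt hm)]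
    simp

/-- A polynomial of degree at most `l` orthogonal to all polynomials of smaller degree is a
multiple of the Legendre polynomial. -/
lemma eq_C_mul_legendreQ (l : ℕ) (q : ℝ[X]) (hq : q.natDegree ≤ l)
    (h : ∀ g : ℝ[X], g.degree < l → intervalInt (q * g) = 0) :
    q = C (q.eval 1) * legendreQ l := by
  set c := q.coeff l / (legendreQ l).coeff l
  have hr := degree_sub_C_mul_legendreQ_lt l q hq
  set r := q - C c * legendreQ l with hrdef
  have h1 : intervalInt (q * r) = 0 := h r hr
  have h2 := intervalInt_legendreQ_mul l r (iterate_derivative_eq_zero_of_degree_lt hr)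
  -- Both `q` and the Legendre polynomial are orthogonal to `r`, whose degree is below `l`; hence
  -- `r` is orthogonal to itself.
  have h3 : r * r = q * r + C (-c) * (legendreQ l * r) := by
    rw [C_neg]; linear_combination r * hrdef
  have h4 : r = 0 := eq_zero_of_intervalInt_sq (by
    rw [h3, intervalInt_add, intervalInt_C_mul, h1, h2]; simp)
  have h5 : q = C c * legendreQ l := by rw [h4] at hrdef; linear_combination -hrdef
  rw [h5, eval_mul, eval_C, eval_legendreQ_one, mul_one]

/-- The Legendre polynomials span the polynomials. -/
lemma legendreQ_induction {M : ℝ[X] → Prop} (hadd : ∀ p q, M p → M q → M (p + q))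
    (hsmul : ∀ c p, M p → M (C c * p)) (hQ : ∀ l, M (legendreQ l)) (p : ℝ[X]) : M p := by
  have key : ∀ (n : ℕ) (p : ℝ[X]), p.degree < n → M p := by
    intro n
    induction n with
    | zero =>
      intro p hp
      have : p = 0 := by simpa using hp
      simpa [this] using hsmul 0 _ (hQ 0)
    | succ n ih =>
      intro p hp
      have hn : p.natDegree ≤ n := by
        rcases eq_or_ne p 0 with rfl | h0
        · simp
        · exact Nat.lt_succ_iff.mp ((natDegree_lt_iff_degree_lt h0).mpr hp)
      simpa using hadd _ _ (ih _ (degree_sub_C_mul_legendreQ_lt n p hn))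
        (hsmul (p.coeff n / (legendreQ n).coeff n) _ (hQ n))
  exact key (p.natDegree + 1) p (degree_le_natDegree.trans_lt (by exact_mod_cast Nat.lt_succ_self _))

end Legendre

/-! ### The sphere: rotations, surface integrals, zonal functions and Funk–Hecke. -/

section Sphere

lemma norm_coe_S2 (x : S2) : ‖(x : E3)‖ = 1 := by simp

lemma inner_self_S2 (x : S2) : inner ℝ (x : E3) (x : E3) = 1 := by
  rw [real_inner_self_eq_norm_sq, norm_coe_S2, one_pow]

lemma inner_mem_Icc (x y : S2) : inner ℝ (x : E3) (y : E3) ∈ Set.Icc (-1 : ℝ) 1 := by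
  have := abs_real_inner_le_norm (x : E3) (y : E3)
  rw [norm_coe_S2, norm_coe_S2, one_mul] at this
  exact abs_le.mp this

lemma continuous_rotate (g : E3 ≃ₗᵢ[ℝ] E3) : Continuous (rotate g) := by
  unfold rotate
  exact (g.continuous.comp continuous_subtype_val).subtype_mk _

lemma coe_rotate (g : E3 ≃ₗᵢ[ℝ] E3) (x : S2) : (rotate g x : E3) = g x := rfl

lemma measurableEmbedding_rotate (g : E3 ≃ₗᵢ[ℝ] E3) : MeasurableEmbedding (rotate g) :=
  ((continuous_rotate g).isClosedEmbedding fun _ _ h =>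
    Subtype.ext (g.injective (congrArg Subtype.val h))).measurableEmbedding

-- Surface measure is defined through the volume of the cone over a set, and an isometry maps cones
-- to cones of equal volume.
open scoped Pointwise in
lemma measurePreserving_rotate (g : E3 ≃ₗᵢ[ℝ] E3) :
    MeasurePreserving (rotate g) sphereMeasure sphereMeasure := by
  refine ⟨(continuous_rotate g).measurable, ?_⟩
  ext s hs
  rw [Measure.map_apply (continuous_rotate g).measurable hs, sphereMeasure,
    Measure.toSphere_apply' _ ((continuous_rotate g).measurable hs), Measure.toSphere_apply' _ hs]
  have : Set.Ioo (0 : ℝ) 1 • ((↑) '' (rotate g ⁻¹' s) : Set E3) =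
      g ⁻¹' (Set.Ioo (0 : ℝ) 1 • ((↑) '' s : Set E3)) := by
    ext z
    simp only [Set.mem_smul, Set.mem_preimage, Set.mem_image]
    constructor
    · rintro ⟨r, hr, _, ⟨w, hw, rfl⟩, rfl⟩
      exact ⟨r, hr, _, ⟨_, hw, rfl⟩, by simp [coe_rotate]⟩
    · rintro ⟨r, hr, _, ⟨w, hw, rfl⟩, hz⟩
      refine ⟨r, hr, _, ⟨rotate g.symm w, ?_, rfl⟩, ?_⟩
      · have : rotate g (rotate g.symm w) = w := Subtype.ext (by simp [coe_rotate])
        rwa [this]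
      · apply g.injective
        simp [coe_rotate, hz]
  rw [this]
  congr 1
  exact g.measurePreserving.measure_preimage_emb g.toHomeomorph.measurableEmbedding _

lemma integral_rotate {F : Type*} [NormedAddCommGroup F] [NormedSpace ℝ F]
    (g : E3 ≃ₗᵢ[ℝ] E3) (f : S2 → F) :
    ∫ x, f (rotate g x) ∂sphereMeasure = ∫ x, f x ∂sphereMeasure :=
  (measurePreserving_rotate g).integral_comp (measurableEmbedding_rotate g) f

instance : IsFiniteMeasure sphereMeasure := by unfold sphereMeasure; infer_instance

instance : sphereMeasure.IsOpenPosMeasure := by unfold sphereMeasure; infer_instance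

lemma det_reflection_eq (K : Submodule ℝ E3) :
    LinearMap.det (K.reflection.toLinearEquiv : E3 →ₗ[ℝ] E3) = (-1) ^ Module.finrank ℝ Kᗮ :=
  K.det_reflection

lemma exists_ne_zero_orthogonal (u v : E3) :
    ∃ n : E3, n ∈ (Submodule.span ℝ {u, v})ᗮ ∧ n ≠ 0 := by
  apply Submodule.exists_mem_ne_zero_of_ne_bot
  intro hbot
  rw [Submodule.orthogonal_eq_bot_iff] at hbot
  have hle := finrank_span_le_card (R := ℝ) ({u, v} : Set E3)
  rw [hbot, finrank_top] at hle
  have hc : ({u, v} : Set E3).toFinset.card ≤ 2 := by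
    classical
    rw [Set.toFinset_insert, Set.toFinset_singleton]
    exact Finset.card_le_two
  have : Module.finrank ℝ E3 = 3 := by simp
  omega

/-- `SO(3)` acts transitively on the pairs of points of the sphere at a given distance. -/
lemma exists_rotation_pair (u v u' v' : S2)
    (h : inner ℝ (u : E3) (v : E3) = inner ℝ (u' : E3) (v' : E3)) :
    ∃ g : E3 ≃ₗᵢ[ℝ] E3, LinearMap.det (g.toLinearEquiv : E3 →ₗ[ℝ] E3) = 1 ∧
      rotate g u = u' ∧ rotate g v = v' := by
  have hmul : ∀ g₁ g₂ : E3 ≃ₗᵢ[ℝ] E3,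
      LinearMap.det ((g₁.trans g₂).toLinearEquiv : E3 →ₗ[ℝ] E3) =
      LinearMap.det (g₂.toLinearEquiv : E3 →ₗ[ℝ] E3) *
        LinearMap.det (g₁.toLinearEquiv : E3 →ₗ[ℝ] E3) := fun g₁ g₂ => by
    rw [← LinearMap.det_comp]; rfl
  set g₁ := (ℝ ∙ ((u : E3) - u'))ᗮ.reflection with hg₁
  have h1 : g₁ u = u' := Submodule.reflection_sub (by rw [norm_coe_S2, norm_coe_S2])
  -- Equality of the inner products makes `u'` orthogonal to `g₁ v - v'`, so this second reflection
  -- corrects `v` without moving `u'`.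
  set g₂ := (ℝ ∙ (g₁ v - v'))ᗮ.reflection with hg₂
  have h2 : g₂ (g₁ v) = v' :=
    Submodule.reflection_sub (by rw [LinearIsometryEquiv.norm_map, norm_coe_S2, norm_coe_S2])
  have h3 : g₂ u' = u' := by
    refine Submodule.reflection_mem_subspace_eq_self ?_
    rw [Submodule.mem_orthogonal_singleton_iff_inner_left, inner_sub_right, ← h, sub_eq_zero]
    nth_rw 1 [← h1]
    exact g₁.inner_map_map _ _
  obtain ⟨n, hn, hn0⟩ := exists_ne_zero_orthogonal (u' : E3) v'
  set g₃ := (ℝ ∙ n)ᗮ.reflection with hg₃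
  have hg3 : ∀ w ∈ ({(u' : E3), (v' : E3)} : Set E3), g₃ w = w := fun w hw => by
    refine Submodule.reflection_mem_subspace_eq_self ?_
    rw [Submodule.mem_orthogonal_singleton_iff_inner_right]
    exact Submodule.mem_orthogonal' _ _ |>.mp hn w (Submodule.subset_span hw)
  have hdet3 : LinearMap.det (g₃.toLinearEquiv : E3 →ₗ[ℝ] E3) = -1 := by
    rw [hg₃, det_reflection_eq, Submodule.orthogonal_orthogonal, finrank_span_singleton hn0,
      pow_one]
  -- A reflection degenerates to the identity when its vector is zero, so the sign is not known. If
  -- it is -1, the reflection `g₃` in a plane containing `u'` and `v'` repairs it.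
  have hdet : LinearMap.det ((g₁.trans g₂).toLinearEquiv : E3 →ₗ[ℝ] E3) = 1 ∨
      LinearMap.det ((g₁.trans g₂).toLinearEquiv : E3 →ₗ[ℝ] E3) = -1 := by
    rw [hmul, hg₁, hg₂, det_reflection_eq, det_reflection_eq, ← pow_add]
    exact neg_one_pow_eq_or _ _
  rcases hdet with hd | hd
  · exact ⟨g₁.trans g₂, hd, Subtype.ext (by simp [coe_rotate, h1, h3]),
      Subtype.ext (by simp [coe_rotate, h2])⟩
  · exact ⟨(g₁.trans g₂).trans g₃, by rw [hmul, hd, hdet3]; norm_num,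
      Subtype.ext (by simp [coe_rotate, h1, h3, hg3]),
      Subtype.ext (by simp [coe_rotate, h2, hg3])⟩

/-- The north pole. -/
noncomputable def northPole : S2 := ⟨!₂[0, 0, 1], by simp [EuclideanSpace.norm_eq, Fin.sum_univ_three]⟩

/-- A curve on the sphere along a meridian, parametrized by height. -/
noncomputable def meridian (t : ℝ) : S2 :=
  ⟨!₂[Real.sin (Real.arccos t), 0, Real.cos (Real.arccos t)], by
    simp [EuclideanSpace.norm_eq, Fin.sum_univ_three]⟩

lemma continuous_meridian : Continuous meridian := by
  unfold meridian
  refine Continuous.subtype_mk ?_ _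
  refine (PiLp.continuous_toLp 2 _).comp ?_
  refine continuous_pi fun i => ?_
  fin_cases i
  · exact Real.continuous_sin.comp Real.continuous_arccos
  · exact continuous_const
  · exact Real.continuous_cos.comp Real.continuous_arccos

lemma inner_northPole (x : S2) : inner ℝ (northPole : E3) (x : E3) = (x : E3) 2 := by
  simp [northPole, PiLp.inner_apply, Fin.sum_univ_three]

lemma inner_northPole_meridian {t : ℝ} (ht : t ∈ Set.Icc (-1 : ℝ) 1) :
    inner ℝ (northPole : E3) (meridian t : E3) = t := by
  rw [inner_northPole]
  simp [meridian, Real.cos_arccos ht.1 ht.2]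

lemma inner_meridian {t : ℝ} (ht : t ∈ Set.Icc (-1 : ℝ) 1) (x : S2) :
    inner ℝ (x : E3) (meridian t : E3) = Real.sqrt (1 - t ^ 2) * (x : E3) 0 + t * (x : E3) 2 := by
  simp [meridian, Real.cos_arccos ht.1 ht.2, Real.sin_arccos, PiLp.inner_apply, Fin.sum_univ_three]

/-- The reflection of `ℝ³` in a coordinate plane. -/
noncomputable def coordReflection (i : Fin 3) : E3 ≃ₗᵢ[ℝ] E3 :=
  (ℝ ∙ (EuclideanSpace.single i (1 : ℝ)))ᗮ.reflection

lemma coordReflection_apply (i j : Fin 3) (x : E3) :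
    coordReflection i x j = if i = j then - x j else x j := by
  rw [coordReflection, Submodule.reflection_orthogonal_apply, Submodule.reflection_singleton_apply]
  rcases eq_or_ne i j with rfl | h
  · simp [EuclideanSpace.inner_single_left]; ring
  · simp [EuclideanSpace.inner_single_left, h, h.symm]

lemma integrable_of_continuous {f : S2 → ℝ} (hf : Continuous f) : Integrable f sphereMeasure :=
  hf.integrable_of_hasCompactSupport (HasCompactSupport.of_compactSpace f)

/-- The Gaussian moment of the last coordinate of ℝ³ is computed in polar and in Cartesian
coordinates; the quotient of the two Gamma values is the spherical moment. -/
lemma integral_sphere_even_pow (n : ℕ) :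
    ∫ x : S2, (x : E3) 2 ^ (2 * n) ∂sphereMeasure = 4 * Real.pi / (2 * n + 1) := by
  have hpolar : ∫ y : E3, y 2 ^ (2 * n) * Real.exp (-‖y‖ ^ 2) =
      (∫ x : S2, (x : E3) 2 ^ (2 * n) ∂sphereMeasure) *
        ∫ r in Set.Ioi (0 : ℝ), r ^ (2 * (n + 1)) * Real.exp (-r ^ 2) := by
    calc ∫ y : E3, y 2 ^ (2 * n) * Real.exp (-‖y‖ ^ 2)
        = ∫ y : ({(0 : E3)}ᶜ : Set E3), (y : E3) 2 ^ (2 * n) * Real.exp (-‖(y : E3)‖ ^ 2)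
            ∂((volume : Measure E3).comap (↑)) := by
          rw [integral_subtype_comap (measurableSet_singleton _).compl
            fun y : E3 => y 2 ^ (2 * n) * Real.exp (-‖y‖ ^ 2), restrict_compl_singleton]
      _ = ∫ p : S2 × Set.Ioi (0 : ℝ), (p.1 : E3) 2 ^ (2 * n) *
            ((p.2 : ℝ) ^ (2 * n) * Real.exp (-(p.2 : ℝ) ^ 2))
            ∂((volume : Measure E3).toSphere.prod
              (Measure.volumeIoiPow (Module.finrank ℝ E3 - 1))) := by
          rw [← (volume : Measure E3).measurePreserving_homeomorphUnitSphereProd.integral_comp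
            (Homeomorph.measurableEmbedding _)]
          refine integral_congr_ae (.of_forall fun y => ?_)
          have hy : ‖(y : E3)‖ ≠ 0 := norm_ne_zero_iff.mpr y.2
          simp only [homeomorphUnitSphereProd_apply_snd_coe, homeomorphUnitSphereProd_apply_fst_coe,
            PiLp.smul_apply, smul_eq_mul, ← mul_assoc, ← mul_pow]
          rw [mul_right_comm, inv_mul_cancel₀ hy, one_mul]
      _ = _ := by
          rw [integral_prod_mul (fun x : S2 => (x : E3) 2 ^ (2 * n))
            (fun r : Set.Ioi (0 : ℝ) => (r : ℝ) ^ (2 * n) * Real.exp (-(r : ℝ) ^ 2))]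
          congr 1
          simp only [Measure.volumeIoiPow, ENNReal.ofReal]
          rw [integral_withDensity_eq_integral_smul
              ((measurable_subtype_coe.pow_const _).real_toNNReal),
            integral_subtype_comap measurableSet_Ioi fun a => Real.toNNReal
              (a ^ (Module.finrank ℝ E3 - 1)) • (a ^ (2 * n) * Real.exp (-a ^ 2))]
          refine setIntegral_congr_fun measurableSet_Ioi fun r hr => ?_
          simp only [NNReal.smul_def]
          rw [Real.coe_toNNReal _ (pow_nonneg (le_of_lt hr) _)]
          simp
          ring
  have hgauss : ∀ m : ℕ, ∫ r in Set.Ioi (0 : ℝ), r ^ (2 * m) * Real.exp (-r ^ 2) =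
      1 / 2 * Real.Gamma (m + 1 / 2) := by
    intro m
    have h := integral_rpow_mul_exp_neg_rpow (p := 2) (q := (2 * m : ℕ)) (by norm_num)
      (by have : (0 : ℝ) ≤ (2 * m : ℕ) := Nat.cast_nonneg _
          linarith)
    rw [show (((2 * m : ℕ) : ℝ) + 1) / 2 = m + 1 / 2 by push_cast; ring] at h
    rw [← h]
    refine setIntegral_congr_fun measurableSet_Ioi fun r hr => ?_
    simp only [Real.rpow_natCast, Real.rpow_two]
  have hfull : ∀ m : ℕ, ∫ r : ℝ, r ^ (2 * m) * Real.exp (-r ^ 2) = Real.Gamma (m + 1 / 2) := by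
    intro m
    have h := integral_comp_abs (f := fun r => r ^ (2 * m) * Real.exp (-r ^ 2))
    simp only [pow_mul, sq_abs] at h ⊢
    rw [h]
    have := hgauss m
    simp only [pow_mul] at this
    rw [this]
    ring
  have hcart : ∫ y : E3, y 2 ^ (2 * n) * Real.exp (-‖y‖ ^ 2) =
      Real.Gamma (n + 1 / 2) * Real.pi := by
    have hmp := (EuclideanSpace.volume_preserving_symm_measurableEquiv_toLp (Fin 3)).symm
    rw [← hmp.integral_comp' (g := fun y : E3 => y 2 ^ (2 * n) * Real.exp (-‖y‖ ^ 2))]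
    have hprod := integral_fintype_prod_volume_eq_prod (𝕜 := ℝ) (ι := Fin 3) (E := fun _ => ℝ)
      (fun i r => (if i = 2 then r ^ (2 * n) else 1) * Real.exp (-r ^ 2))
    have h0 := hfull 0
    simp only [mul_zero, pow_zero, one_mul, Nat.cast_zero, zero_add] at h0
    rw [Real.Gamma_one_half_eq] at h0
    have hpi := Real.mul_self_sqrt Real.pi_pos.le
    simp only [Fin.prod_univ_three] at hprod
    simp [h0, hfull] at hprod
    rw [mul_comm (Real.Gamma _), ← hpi]
    rw [show Real.Gamma (n + 1 / 2) = Real.Gamma (n + 2⁻¹) by norm_num, ← hprod]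
    refine integral_congr_ae (.of_forall fun x => ?_)
    simp only [EuclideanSpace.norm_sq_eq, Fin.sum_univ_three, Real.norm_eq_abs, sq_abs, neg_add,
      Real.exp_add]
    simp
    ring
  rw [hcart, hgauss (n + 1)] at hpolar
  have hG : Real.Gamma ((n + 1 : ℕ) + 1 / 2) = (n + 1 / 2) * Real.Gamma (n + 1 / 2) := by
    rw [← Real.Gamma_add_one (by positivity)]
    congr 1
    push_cast; ring
  rw [hG] at hpolar
  have hpos : 0 < Real.Gamma (n + 1 / 2) := Real.Gamma_pos_of_pos (by positivity)
  field_simp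
  apply mul_left_cancel₀ hpos.ne'
  linear_combination (-4) * hpolar


lemma integral_rotate_odd {f : S2 → ℝ} (g : E3 ≃ₗᵢ[ℝ] E3) (h : ∀ x, f (rotate g x) = -f x) :
    ∫ x, f x ∂sphereMeasure = 0 := by
  have := integral_rotate g f
  simp only [h, integral_neg] at this
  linarith

-- Archimedes: the height of a uniform point of the sphere is uniform on [-1, 1]. Even monomials are
-- the moments above, odd ones vanish by reflection.
open Polynomial in
lemma integral_eval_coord (p : ℝ[X]) :
    ∫ x : S2, p.eval ((x : E3) 2) ∂sphereMeasure = 2 * Real.pi * intervalInt p := by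
  have hc : ∀ q : ℝ[X], Integrable (fun x : S2 => q.eval ((x : E3) 2)) sphereMeasure := fun q =>
    integrable_of_continuous (by fun_prop)
  induction p using Polynomial.induction_on' with
  | add p q hp hq =>
    simp only [eval_add]
    rw [integral_add (hc p) (hc q), hp, hq, intervalInt_add]
    ring
  | monomial n a =>
    rw [← C_mul_X_pow_eq_monomial, intervalInt_C_mul]
    simp only [eval_mul, eval_C, eval_pow, eval_X, integral_const_mul, intervalInt, integral_pow]
    rcases Nat.even_or_odd n with hn | hn
    · obtain ⟨k, rfl⟩ := hn
      rw [← two_mul, integral_sphere_even_pow, pow_succ (-1 : ℝ), pow_mul]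
      push_cast
      norm_num
      ring
    · have : ∫ x : S2, (x : E3) 2 ^ n ∂sphereMeasure = 0 := by
        apply integral_rotate_odd (coordReflection 2)
        intro x
        rw [coe_rotate, coordReflection_apply, if_pos rfl, hn.neg_pow]
      rw [this, hn.add_one.neg_one_pow]
      simp

lemma inner_rotate (g : E3 ≃ₗᵢ[ℝ] E3) (x y : S2) :
    inner ℝ (rotate g x : E3) (rotate g y : E3) = inner ℝ (x : E3) (y : E3) := by
  simp [coe_rotate]

open Polynomial in
lemma integral_eval_inner (p : ℝ[X]) (n : S2) :
    ∫ x : S2, p.eval (inner ℝ (n : E3) (x : E3)) ∂sphereMeasure = 2 * Real.pi * intervalInt p := by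
  obtain ⟨g, -, hg, -⟩ := exists_rotation_pair n n northPole northPole (by
    rw [inner_self_S2, inner_self_S2])
  rw [← integral_eval_coord,
    ← integral_rotate g fun x : S2 => p.eval ((x : E3) 2)]
  simp only [← inner_northPole, ← hg, inner_rotate]

-- Odd powers of √(1 - t²) come with odd powers of the first coordinate, which integrate to zero by
-- reflection. Only even powers remain, and these are polynomials in `t`.
open Polynomial in
lemma exists_polynomial_meridian_pow (κ : ℝ → ℝ) (hκ : Continuous κ) (m : ℕ) :
    ∃ q : ℝ[X], q.natDegree ≤ m ∧ ∀ t ∈ Set.Icc (-1 : ℝ) 1,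
      ∫ u : S2, κ ((u : E3) 2) * (Real.sqrt (1 - t ^ 2) * (u : E3) 0 + t * (u : E3) 2) ^ m
        ∂sphereMeasure = q.eval t := by
  set a : ℕ → ℝ := fun j => ∫ u : S2, κ ((u : E3) 2) * ((u : E3) 0 ^ j * (u : E3) 2 ^ (m - j))
    ∂sphereMeasure with ha
  -- The rounding in `j / 2` is harmless, because `a j` vanishes for odd `j`.
  refine ⟨∑ j ∈ Finset.range (m + 1), C (a j * (m.choose j : ℝ)) *
    ((1 - X ^ 2) ^ (j / 2) * X ^ (m - j)), ?_, fun t ht => ?_⟩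
  · refine natDegree_sum_le_of_forall_le _ _ fun j hj => ?_
    have hj' := Finset.mem_range.mp hj
    refine (natDegree_C_mul_le _ _).trans (natDegree_mul_le.trans ?_)
    rw [natDegree_X_pow]
    have h1 : ((1 - X ^ 2 : ℝ[X]) ^ (j / 2)).natDegree ≤ (j / 2) * 2 := by
      refine natDegree_pow_le.trans (Nat.mul_le_mul_left _ ?_)
      refine (natDegree_sub_le _ _).trans ?_
      simp
    omega
  · have ht2 : 0 ≤ 1 - t ^ 2 := by nlinarith [ht.1, ht.2]
    calc ∫ u : S2, κ ((u : E3) 2) * (Real.sqrt (1 - t ^ 2) * (u : E3) 0 + t * (u : E3) 2) ^ m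
        ∂sphereMeasure
        = ∫ u : S2, ∑ j ∈ Finset.range (m + 1), (Real.sqrt (1 - t ^ 2) ^ j * t ^ (m - j) *
            (m.choose j : ℝ)) * (κ ((u : E3) 2) * ((u : E3) 0 ^ j * (u : E3) 2 ^ (m - j)))
            ∂sphereMeasure := by
          refine integral_congr_ae (.of_forall fun u => ?_)
          simp only [add_pow, Finset.mul_sum, mul_pow]
          exact Finset.sum_congr rfl fun j _ => by ring
      _ = _ := by
          rw [integral_finsetSum _ fun j _ => (integrable_of_continuous (by fun_prop)).const_mul _,
            eval_finsetSum]
          refine Finset.sum_congr rfl fun j _ => ?_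
          rw [integral_const_mul]
          change _ * a j = _
          rcases Nat.even_or_odd j with hj | hj
          · obtain ⟨k, rfl⟩ := hj
            have hk : (k + k) / 2 = k := by omega
            rw [← two_mul, pow_mul, Real.sq_sqrt ht2, two_mul, hk]
            simp
            ring
          · have : a j = 0 := by
              apply integral_rotate_odd (coordReflection 0)
              intro x
              rw [coe_rotate, coordReflection_apply, coordReflection_apply, if_pos rfl,
                if_neg (by decide), hj.neg_pow]
              ring
            simp [this]

open Polynomial in
/-- Zonal kernels map zonal polynomials to zonal polynomials without raising the degree. -/
lemma exists_polynomial_kernel (κ : ℝ → ℝ) (hκ : Continuous κ) (p : ℝ[X]) :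
    ∃ q : ℝ[X], q.natDegree ≤ p.natDegree ∧ ∀ x y : S2,
      ∫ u : S2, κ (inner ℝ (x : E3) (u : E3)) * p.eval (inner ℝ (u : E3) (y : E3))
        ∂sphereMeasure = q.eval (inner ℝ (x : E3) (y : E3)) := by
  choose q hqdeg hq using exists_polynomial_meridian_pow κ hκ
  refine ⟨∑ i ∈ Finset.range (p.natDegree + 1), C (p.coeff i) * q i, ?_, fun x y => ?_⟩
  · refine natDegree_sum_le_of_forall_le _ _ fun i hi => ?_
    exact (natDegree_C_mul_le _ _).trans ((hqdeg i).trans (Finset.mem_range_succ_iff.mp hi))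
  · set t := inner ℝ (x : E3) (y : E3)
    have ht : t ∈ Set.Icc (-1 : ℝ) 1 := inner_mem_Icc x y
    obtain ⟨g, -, hgx, hgy⟩ := exists_rotation_pair x y northPole (meridian t)
      (inner_northPole_meridian ht).symm
    calc ∫ u : S2, κ (inner ℝ (x : E3) (u : E3)) * p.eval (inner ℝ (u : E3) (y : E3))
        ∂sphereMeasure
        = ∫ u : S2, κ ((u : E3) 2) * p.eval (inner ℝ (u : E3) (meridian t : E3))
            ∂sphereMeasure := by
          rw [← integral_rotate g fun u : S2 =>
            κ ((u : E3) 2) * p.eval (inner ℝ (u : E3) (meridian t : E3))]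
          simp only [← inner_northPole, ← hgx, ← hgy, inner_rotate]
      _ = ∫ u : S2, ∑ i ∈ Finset.range (p.natDegree + 1), p.coeff i * (κ ((u : E3) 2) *
            (Real.sqrt (1 - t ^ 2) * (u : E3) 0 + t * (u : E3) 2) ^ i) ∂sphereMeasure := by
          refine integral_congr_ae (.of_forall fun u => ?_)
          simp only [inner_meridian ht, eval_eq_sum_range, Finset.mul_sum]
          exact Finset.sum_congr rfl fun j _ => by ring
      _ = _ := by
          rw [integral_finsetSum _ fun j _ => (integrable_of_continuous (by fun_prop)).const_mul _,
            eval_finsetSum]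
          refine Finset.sum_congr rfl fun j _ => ?_
          rw [integral_const_mul, hq j t ht, eval_mul, eval_C]

/-- The value of the Legendre polynomial at the inner product of two points. -/
noncomputable def zonal (l : ℕ) (x y : S2) : ℝ :=
  (legendreQ l).eval (inner ℝ (x : E3) (y : E3))

lemma continuous_inner_S2 :
    Continuous fun p : S2 × S2 => inner ℝ (p.1 : E3) (p.2 : E3) := by fun_prop

lemma continuous_zonal (l : ℕ) : Continuous fun p : S2 × S2 => zonal l p.1 p.2 :=
  (legendreQ l).continuous.comp continuous_inner_S2

@[fun_prop]
lemma continuous_zonal_right (l : ℕ) (x : S2) : Continuous fun y => zonal l x y :=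
  (continuous_zonal l).comp (by fun_prop : Continuous fun y : S2 => (x, y))

@[fun_prop]
lemma continuous_zonal_left (l : ℕ) (y : S2) : Continuous fun x => zonal l x y :=
  (continuous_zonal l).comp (by fun_prop : Continuous fun x : S2 => (x, y))

lemma zonal_self (l : ℕ) (x : S2) : zonal l x x = 1 := by
  rw [zonal, inner_self_S2, eval_legendreQ_one]

lemma zonal_comm (l : ℕ) (x y : S2) : zonal l x y = zonal l y x := by
  rw [zonal, zonal, real_inner_comm]

open Polynomial in
/-- The Funk–Hecke formula. -/
lemma integral_kernel_mul_zonal (κ : ℝ → ℝ) (hκ : Continuous κ) (l : ℕ) (x y n : S2) :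
    ∫ u : S2, κ (inner ℝ (x : E3) (u : E3)) * zonal l u y ∂sphereMeasure =
      (∫ u : S2, κ (inner ℝ (n : E3) (u : E3)) * zonal l n u ∂sphereMeasure) * zonal l x y := by
  obtain ⟨q, hqdeg, hq⟩ := exists_polynomial_kernel κ hκ (legendreQ l)
  -- The kernel is symmetric, so Fubini moves it from Q_l onto `g`. The image `r` of `g` still has
  -- degree below `l`, where Q_l is orthogonal to everything.
  have horth : ∀ g : ℝ[X], g.degree < l → intervalInt (q * g) = 0 := by
    intro g hg
    obtain ⟨r, hrdeg, hr⟩ := exists_polynomial_kernel κ hκ g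
    have h1 : 2 * Real.pi * intervalInt (q * g) = 2 * Real.pi * intervalInt (legendreQ l * r) := by
      rw [← integral_eval_inner _ n, ← integral_eval_inner _ n]
      simp only [eval_mul]
      calc ∫ x : S2, q.eval (inner ℝ (n : E3) (x : E3)) * g.eval (inner ℝ (n : E3) (x : E3))
            ∂sphereMeasure
          = ∫ x : S2, ∫ u : S2, κ (inner ℝ (x : E3) (u : E3)) *
              (legendreQ l).eval (inner ℝ (u : E3) (n : E3)) * g.eval (inner ℝ (x : E3) (n : E3))
              ∂sphereMeasure ∂sphereMeasure := by
            refine integral_congr_ae (.of_forall fun x => ?_)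
            simp only [integral_mul_const, hq, real_inner_comm (n : E3) (x : E3)]
        _ = ∫ u : S2, ∫ x : S2, κ (inner ℝ (x : E3) (u : E3)) *
              (legendreQ l).eval (inner ℝ (u : E3) (n : E3)) * g.eval (inner ℝ (x : E3) (n : E3))
              ∂sphereMeasure ∂sphereMeasure := by
            refine integral_integral_swap ?_
            refine Continuous.integrable_of_hasCompactSupport ?_ (HasCompactSupport.of_compactSpace _)
            fun_prop
        _ = _ := by
            refine integral_congr_ae (.of_forall fun u => ?_)
            simp only
            rw [real_inner_comm (u : E3) (n : E3), ← hr, ← integral_const_mul]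
            refine integral_congr_ae (.of_forall fun x => ?_)
            simp only [real_inner_comm (u : E3) (x : E3)]
            ring
    have hr' : derivative^[l] r = 0 := by
      -- The bound on `natDegree` says nothing about vanishing when `g = 0` and `l = 0`; there `r`
      -- is zero because it represents the zero integral.
      rcases eq_or_ne g 0 with rfl | hg0
      · rcases l with _ | l
        · have : intervalInt (r * r) = 0 := by
            have := integral_eval_inner (r * r) n
            simp only [eval_mul, ← hr, eval_zero, mul_zero, integral_zero] at this
            have hpi := Real.pi_pos
            rcases mul_eq_zero.mp this.symm with h | h
            · linarith
            · exact h
          simp [eq_zero_of_intervalInt_sq this]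
        · exact iterate_derivative_eq_zero (by simp at hrdeg; omega)
      · refine iterate_derivative_eq_zero (hrdeg.trans_lt ?_)
        exact (natDegree_lt_iff_degree_lt hg0).mpr hg
    rw [intervalInt_legendreQ_mul l r hr', mul_zero] at h1
    have hpi := Real.pi_pos
    rcases mul_eq_zero.mp h1 with h | h
    · linarith
    · exact h
  have hq1 := eq_C_mul_legendreQ l q (hqdeg.trans (natDegree_legendreQ_le l)) horth
  have h1 : q.eval 1 =
      ∫ u : S2, κ (inner ℝ (n : E3) (u : E3)) * zonal l n u ∂sphereMeasure := by
    have := hq n n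
    rw [inner_self_S2] at this
    rw [← this]
    refine integral_congr_ae (.of_forall fun u => ?_)
    simp only [zonal, real_inner_comm (u : E3) (n : E3)]
  have h2 := hq x y
  rw [hq1, eval_mul, eval_C, h1] at h2
  exact h2

lemma integral_zonal_mul_self (l : ℕ) (n : S2) :
    ∫ u : S2, zonal l n u * zonal l n u ∂sphereMeasure = 4 * Real.pi / (2 * l + 1) := by
  have := integral_eval_inner (legendreQ l * legendreQ l) n
  rw [intervalInt_legendreQ_sq] at this
  simp only [Polynomial.eval_mul] at this
  simp only [zonal, this]
  ring

lemma integral_zonal_mul_of_ne {k l : ℕ} (h : k ≠ l) (n : S2) :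
    ∫ u : S2, zonal k n u * zonal l n u ∂sphereMeasure = 0 := by
  wlog hlt : k < l generalizing k l
  · simp only [mul_comm (zonal k n _)]
    exact this h.symm (by omega)
  have := integral_eval_inner (legendreQ l * legendreQ k) n
  rw [intervalInt_legendreQ_mul l _ (Polynomial.iterate_derivative_eq_zero
    ((natDegree_legendreQ_le k).trans_lt hlt))] at this
  simp only [Polynomial.eval_mul, mul_zero] at this
  simpa only [zonal, mul_comm] using this

lemma integral_zonal_mul_zonal (k l : ℕ) (x y : S2) :
    ∫ u : S2, zonal k x u * zonal l u y ∂sphereMeasure =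
      if k = l then 4 * Real.pi / (2 * l + 1) * zonal l x y else 0 := by
  have := integral_kernel_mul_zonal (fun t => (legendreQ k).eval t) (legendreQ k).continuous l x y x
  change ∫ u : S2, zonal k x u * zonal l u y ∂sphereMeasure =
    (∫ u : S2, zonal k x u * zonal l x u ∂sphereMeasure) * zonal l x y at this
  rw [this]
  split_ifs with h
  · rw [h, integral_zonal_mul_self]
  · rw [integral_zonal_mul_of_ne h, zero_mul]

/-- By the reproducing identity the value is, up to 4π/(2l+1), an L² inner product of two zonal
functions of equal norm, so Cauchy–Schwarz (here 2|ab| ≤ a² + b²) applies. -/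
lemma abs_zonal_le_one (l : ℕ) (x y : S2) : |zonal l x y| ≤ 1 := by
  have hi : ∀ x y : S2, Integrable (fun u => zonal l x u * zonal l u y) sphereMeasure := fun x y =>
    integrable_of_continuous (by fun_prop)
  have hs : ∀ x : S2, Integrable (fun u => zonal l x u * zonal l x u) sphereMeasure := fun x =>
    integrable_of_continuous (by fun_prop)
  have hc : 0 < 4 * Real.pi / (2 * (l : ℝ) + 1) := by positivity
  have hxy := integral_zonal_mul_zonal l l x y
  rw [if_pos rfl] at hxy
  have key : |∫ u : S2, zonal l x u * zonal l u y ∂sphereMeasure| ≤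
      ∫ u : S2, (1 / 2 * (zonal l x u * zonal l x u) + 1 / 2 * (zonal l y u * zonal l y u))
        ∂sphereMeasure := by
    refine (abs_integral_le_integral_abs).trans (integral_mono (hi x y).abs
      (((hs x).const_mul _).add ((hs y).const_mul _)) fun u => ?_)
    simp only [zonal_comm l u y]
    rw [abs_le]
    constructor <;> nlinarith [sq_nonneg (zonal l x u - zonal l y u),
      sq_nonneg (zonal l x u + zonal l y u)]
  rw [integral_add ((hs x).const_mul _) ((hs y).const_mul _), integral_const_mul,
    integral_const_mul, integral_zonal_mul_self, integral_zonal_mul_self, hxy, abs_mul,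
    abs_of_pos hc] at key
  have : 4 * Real.pi / (2 * (l : ℝ) + 1) * |zonal l x y| ≤ 4 * Real.pi / (2 * (l : ℝ) + 1) * 1 := by
    linarith
  exact le_of_mul_le_mul_left this hc

end Sphere

/-! ### Zonal functions as eigenfunctions of the spherical Laplacian. -/

section Laplacian

open Polynomial

lemma hasDerivAt_inv_norm_line (x e : E3) (s : ℝ) (hs : x + s • e ≠ 0) :
    HasDerivAt (fun s : ℝ => ‖x + s • e‖⁻¹)
      (-(inner ℝ (x + s • e) e) * ‖x + s • e‖⁻¹ ^ 3) s := by
  have hL : HasDerivAt (fun s : ℝ => x + s • e) e s := by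
    simpa using ((hasDerivAt_id s).smul_const e).const_add x
  have hn := hL.norm_sq.sqrt (by positivity)
  simp only [Real.sqrt_sq (norm_nonneg _)] at hn
  have h0 : ‖x + s • e‖ ≠ 0 := norm_ne_zero_iff.mpr hs
  exact (hn.fun_inv h0).congr_deriv (by field_simp)

/-- The derivatives of a zonal function, extended along rays, along a line. -/
lemma hasDerivAt_ray_extension (p : ℝ[X]) (v x e : E3) (s : ℝ) (hs : x + s • e ≠ 0) :
    HasDerivAt (fun s : ℝ => p.eval (inner ℝ (‖x + s • e‖⁻¹ • (x + s • e)) v))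
      ((derivative p).eval (inner ℝ (‖x + s • e‖⁻¹ • (x + s • e)) v) *
        (‖x + s • e‖⁻¹ * inner ℝ e v -
          inner ℝ (x + s • e) e * ‖x + s • e‖⁻¹ ^ 3 * inner ℝ (x + s • e) v)) s := by
  have hL : HasDerivAt (fun s : ℝ => x + s • e) e s := by
    simpa using ((hasDerivAt_id s).smul_const e).const_add x
  have ha : HasDerivAt (fun s : ℝ => inner ℝ (x + s • e) v) (inner ℝ e v) s := by
    simpa using hL.inner ℝ (hasDerivAt_const s v)
  have hw := hasDerivAt_inv_norm_line x e s hs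
  simp only [real_inner_smul_left]
  exact ((p.hasDerivAt _).comp s (hw.fun_mul ha)).congr_deriv (by ring)

lemma hasDerivAt_fderiv_line {G : E3 → ℝ} {x e : E3} (h : DifferentiableAt ℝ (fderiv ℝ G) x) :
    HasDerivAt (fun s : ℝ => fderiv ℝ G (x + s • e) e) (fderiv ℝ (fderiv ℝ G) x e e) 0 := by
  have hL : HasDerivAt (fun s : ℝ => x + s • e) e 0 := by
    simpa using ((hasDerivAt_id (0 : ℝ)).smul_const e).const_add x
  have h1 : HasFDerivAt (fderiv ℝ G) (fderiv ℝ (fderiv ℝ G) x) (x + (0 : ℝ) • e) := by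
    rw [zero_smul, add_zero]
    exact h.hasFDerivAt
  have h2 : HasDerivAt (fun s : ℝ => fderiv ℝ G (x + s • e)) (fderiv ℝ (fderiv ℝ G) x e) 0 :=
    h1.comp_hasDerivAt (0 : ℝ) hL
  simpa using h2.clm_apply (hasDerivAt_const (0 : ℝ) e)

/-- The Laplacian needs only diagonal second derivatives, which are second derivatives along the
lines `x + s • e` at `s = 0`. -/
lemma iteratedFDeriv_ray_extension (p : ℝ[X]) (v x e : E3) (hx : ‖x‖ = 1) :
    iteratedFDeriv ℝ 2 (fun y : E3 => p.eval (inner ℝ (‖y‖⁻¹ • y) v)) x ![e, e] =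
      (derivative (derivative p)).eval (inner ℝ x v) * (inner ℝ e v - inner ℝ x e * inner ℝ x v) ^ 2
      + (derivative p).eval (inner ℝ x v) * (-2 * (inner ℝ x e * inner ℝ e v)
        - inner ℝ e e * inner ℝ x v + 3 * (inner ℝ x e * inner ℝ x e) * inner ℝ x v) := by
  set G : E3 → ℝ := fun y => p.eval (inner ℝ (‖y‖⁻¹ • y) v) with hG
  have hx0 : x ≠ 0 := by rintro rfl; simp at hx
  have hGc : ∀ y : E3, y ≠ 0 → ContDiffAt ℝ 2 G y := by
    intro y hy
    have h1 : ContDiffAt ℝ 2 (fun y : E3 => inner ℝ (‖y‖⁻¹ • y) v) y :=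
      (((contDiffAt_norm ℝ hy).inv (norm_ne_zero_iff.mpr hy)).smul contDiffAt_id).inner ℝ
        contDiffAt_const
    have h2 : ContDiff ℝ 2 (fun t : ℝ => p.eval t) := p.contDiff_aeval 2
    exact h2.contDiffAt.comp y h1
  have hL : ∀ s : ℝ, HasDerivAt (fun s : ℝ => x + s • e) e s := fun s => by
    simpa using ((hasDerivAt_id s).smul_const e).const_add x
  have hfd : ∀ s : ℝ, x + s • e ≠ 0 → fderiv ℝ G (x + s • e) e =
      (derivative p).eval (inner ℝ (‖x + s • e‖⁻¹ • (x + s • e)) v) *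
        (‖x + s • e‖⁻¹ * inner ℝ e v -
          inner ℝ (x + s • e) e * ‖x + s • e‖⁻¹ ^ 3 * inner ℝ (x + s • e) v) := by
    intro s hs
    have h1 := ((hGc _ hs).differentiableAt (by norm_num)).hasFDerivAt.comp_hasDerivAt s (hL s)
    exact h1.unique (hasDerivAt_ray_extension p v x e s hs)
  rw [iteratedFDeriv_two_apply]
  simp only [Matrix.cons_val_zero, Matrix.cons_val_one]
  have hd2 : DifferentiableAt ℝ (fderiv ℝ G) x :=
    ((hGc x hx0).fderiv_right (m := 1) (by norm_num)).differentiableAt (by norm_num)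
  have h2 := hasDerivAt_fderiv_line (e := e) hd2
  have hne : ∀ᶠ s : ℝ in 𝓝 0, x + s • e ≠ 0 := by
    have : ContinuousAt (fun s : ℝ => x + s • e) 0 := (hL 0).continuousAt
    exact this.eventually_ne (by simpa using hx0)
  have h00 : x + (0 : ℝ) • e ≠ 0 := by simpa using hx0
  have h3 := h2.congr_of_eventuallyEq (f₁ := fun s : ℝ =>
    (derivative p).eval (inner ℝ (‖x + s • e‖⁻¹ • (x + s • e)) v) *
        (‖x + s • e‖⁻¹ * inner ℝ e v -
          inner ℝ (x + s • e) e * ‖x + s • e‖⁻¹ ^ 3 * inner ℝ (x + s • e) v))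
    (hne.mono fun s hs => (hfd s hs).symm)
  have ha : ∀ w : E3, HasDerivAt (fun s : ℝ => inner ℝ (x + s • e) w) (inner ℝ e w) 0 := fun w => by
    simpa using (hL 0).inner ℝ (hasDerivAt_const 0 w)
  have hw := hasDerivAt_inv_norm_line x e 0 h00
  have h4 := (hasDerivAt_ray_extension (derivative p) v x e 0 h00).mul
    ((hw.mul_const (inner ℝ e v)).sub (((ha e).mul (hw.pow 3)).mul (ha v)))
  have h5 := h3.unique h4
  rw [h5]
  simp [hx]
  ring

/-- Summing over an orthonormal basis, Σ⟨x,e⟩² and Σ⟨e,v⟩² become 1 and Σ⟨x,e⟩⟨e,v⟩ becomes t =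
⟨x,v⟩, which leaves the Legendre operator in t. -/
lemma sphericalLaplacian_zonal (p : ℝ[X]) (v x : S2) :
    sphericalLaplacian (fun y => p.eval (inner ℝ y (v : E3))) x =
      (1 - inner ℝ (x : E3) (v : E3) ^ 2) *
        (derivative (derivative p)).eval (inner ℝ (x : E3) (v : E3))
      - 2 * inner ℝ (x : E3) (v : E3) * (derivative p).eval (inner ℝ (x : E3) (v : E3)) := by
  rw [sphericalLaplacian,
    laplacian_eq_iteratedFDeriv_orthonormalBasis _ (EuclideanSpace.basisFun (Fin 3) ℝ)]
  simp only [iteratedFDeriv_ray_extension _ _ _ _ (norm_coe_S2 x)]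
  have hx := inner_self_S2 x
  have hv := inner_self_S2 v
  set t := inner ℝ (x : E3) (v : E3) with ht
  have ht' := ht
  simp only [PiLp.inner_apply, Fin.sum_univ_three, RCLike.inner_apply, conj_trivial] at hx hv ht'
  simp only [Fin.sum_univ_three, EuclideanSpace.basisFun_apply, EuclideanSpace.inner_single_left,
    EuclideanSpace.inner_single_right]
  simp
  linear_combination (derivative (derivative p)).eval t * (hv + t ^ 2 * hx + 2 * t * ht') +
    (derivative p).eval t * (3 * t * hx + 2 * ht')

lemma sphericalLaplacian_legendreQ (l : ℕ) (v x : S2) :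
    sphericalLaplacian (fun y => (legendreQ l).eval (inner ℝ y (v : E3))) x =
      -sphereEigenvalue l * zonal l x v := by
  have h := congrArg (Polynomial.eval (inner ℝ (x : E3) (v : E3))) (legendreQ_ode l)
  simp only [eval_mul, eval_sub, eval_one, eval_pow, eval_X, eval_neg, eval_C, eval_ofNat,
    Function.iterate_succ_apply', Function.iterate_zero, id] at h
  rw [sphericalLaplacian_zonal, zonal, ← h]

end Laplacian

/-! ### Decay of zonal means along Brownian motion, conditioning, and the time change. -/

section BrownianMotion

/-- Taking expectations in the martingale problem for an eigenfunction gives f(t) = f(0) - μ∫₀ᵗ f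
for the mean f, whose only continuous solution is exponential. -/
lemma integral_zonal_rotationalBM {Ω : Type*} [MeasurableSpace Ω] {P : Measure Ω}
    [IsProbabilityMeasure P] {B : ℝ≥0 → Ω → S2} {x : S2} (hB : IsRotationalBM B x P)
    (l : ℕ) (v : S2) (t : ℝ≥0) :
    ∫ ω, zonal l (B t ω) v ∂P = Real.exp (-sphereEigenvalue l * t) * zonal l x v := by
  set μ := sphereEigenvalue l
  have hjm : Measurable (fun p : ℝ × Ω => B p.1.toNNReal p.2) :=
    (measurable_uncurry_of_continuous_of_measurable (u := B) hB.continuous_paths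
      hB.measurable).comp (measurable_real_toNNReal.prodMap measurable_id)
  have hz : Measurable fun y => zonal l y v := (continuous_zonal_left l v).measurable
  have hb : ∀ y, ‖zonal l y v‖ ≤ 1 := fun y => abs_zonal_le_one l y v
  have hint : ∀ t : ℝ≥0, Integrable (fun ω => zonal l (B t ω) v) P := fun t =>
    Integrable.of_bound (hz.comp (hB.measurable t)).aestronglyMeasurable 1
      (.of_forall fun ω => hb _)
  set f : ℝ → ℝ := fun s => ∫ ω, zonal l (B s.toNNReal ω) v ∂P with hf
  have hfc : Continuous f := by
    refine continuous_of_dominated (bound := fun _ => 1)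
      (fun s => (hint _).aestronglyMeasurable) (fun s => .of_forall fun ω => hb _)
      (integrable_const _) (.of_forall fun ω => ?_)
    exact (continuous_zonal_left l v).comp ((hB.continuous_paths ω).comp continuous_real_toNNReal)
  have hint2 : ∀ t : ℝ, Integrable (fun p : ℝ × Ω => zonal l (B p.1.toNNReal p.2) v)
      ((volume.restrict (Set.Ioc 0 t)).prod P) := fun t =>
    Integrable.of_bound (hz.comp hjm).aestronglyMeasurable 1 (.of_forall fun p => hb _)
  have hf0 : f 0 = zonal l x v := by
    have : (fun ω => zonal l (B (0 : ℝ).toNNReal ω) v) =ᵐ[P] fun _ => zonal l x v := by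
      filter_upwards [hB.start] with ω hω
      rw [Real.toNNReal_zero, hω]
    simp [hf, integral_congr_ae this]
  have hmain : ∀ t : ℝ, 0 ≤ t → f t = f 0 - μ * ∫ s in (0 : ℝ)..t, f s := by
    intro t ht
    have hM := hB.martingale (fun y => (legendreQ l).eval (inner ℝ y (v : E3)))
      (((legendreQ l).contDiff_aeval _).comp (contDiff_id.inner ℝ contDiff_const))
    have hE := hM.setIntegral_eq (zero_le (a := t.toNNReal)) MeasurableSet.univ
    simp only [setIntegral_univ, sphericalLaplacian_legendreQ] at hE
    change ∫ ω, (zonal l (B 0 ω) v - zonal l (B 0 ω) v - _) ∂P = ∫ ω, (zonal l (B _ ω) v -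
      zonal l (B 0 ω) v - _) ∂P at hE
    simp only [NNReal.coe_zero, intervalIntegral.integral_same, sub_self, integral_zero,
      integral_const_mul, Real.coe_toNNReal t ht,
      intervalIntegral.integral_of_le ht] at hE
    have hI := (hint2 t).integral_prod_right
    have hsub : Integrable (fun ω => zonal l (B t.toNNReal ω) v - zonal l (B 0 ω) v) P :=
      (hint _).sub (hint _)
    rw [integral_sub hsub (hI.const_mul _), integral_sub (hint _) (hint _),
      integral_const_mul, ← integral_integral_swap (hint2 t)] at hE
    rw [intervalIntegral.integral_of_le ht]
    simp only [hf, Real.toNNReal_zero]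
    linear_combination -hE
  set I : ℝ → ℝ := fun t => ∫ s in (0 : ℝ)..t, f s with hI
  have hId : ∀ t, HasDerivAt I (f t) t := fun t => hfc.integral_hasStrictDerivAt 0 t |>.hasDerivAt
  have hφ : ∀ t, HasDerivAt (fun t => Real.exp (μ * t) * (f 0 - μ * I t))
      (Real.exp (μ * t) * μ * (f 0 - μ * I t) + Real.exp (μ * t) * (-(μ * f t))) t := fun t => by
    have h1 : HasDerivAt (fun t => Real.exp (μ * t)) (Real.exp (μ * t) * μ) t := by
      simpa using ((hasDerivAt_id t).const_mul μ).exp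
    exact h1.mul (((hId t).const_mul μ).const_sub (f 0))
  -- With the integrating factor the derivative is zero. This holds only for nonnegative times,
  -- where `hmain` identifies `f 0 - μ * I s` with `f s`.
  have hconst := constant_of_has_deriv_right_zero (a := 0) (b := (t : ℝ))
    (f := fun t => Real.exp (μ * t) * (f 0 - μ * I t))
    (fun s _ => (hφ s).continuousAt.continuousWithinAt)
    (fun s hs => by
      have := (hφ s).hasDerivWithinAt (s := Set.Ici s)
      rw [hmain s hs.1] at this
      convert this using 1
      ring) t ⟨t.2, le_rfl⟩
  have hft := hmain t t.2
  simp only [I, ← hft] at hconst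
  simp only [mul_zero, Real.exp_zero, intervalIntegral.integral_same, sub_zero, one_mul,
    hf0] at hconst
  have : f t = ∫ ω, zonal l (B t ω) v ∂P := by simp [hf]
  rw [← this, neg_mul, Real.exp_neg, ← hconst]
  field_simp

lemma integrable_prod_of_integral_abs_le {Ω E : Type*} [MeasurableSpace Ω] [MeasurableSpace E]
    {P : Measure Ω} [SFinite P] {ν : Measure E} [IsFiniteMeasure ν] {G : Ω × E → ℝ}
    (hG : Measurable G) {C : ℝ} (hint : ∀ z, Integrable (fun ω => G (ω, z)) P)
    (hC : ∀ z, ∫ ω, |G (ω, z)| ∂P ≤ C) : Integrable G (P.prod ν) := by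
  rw [integrable_prod_iff' hG.aestronglyMeasurable]
  refine ⟨.of_forall hint, Integrable.of_bound
    (hG.norm.stronglyMeasurable.integral_prod_left').aestronglyMeasurable C (.of_forall fun z => ?_)⟩
  rw [Real.norm_of_nonneg (integral_nonneg fun _ => norm_nonneg _)]
  exact hC z

/-- The freezing lemma: the joint law is a product, and a bound on the sections uniform in `z`
supplies the integrability that Fubini needs. -/
lemma integrable_and_integral_comp_of_indepFun {Ω : Type*} [MeasurableSpace Ω] {P : Measure Ω}
    [IsProbabilityMeasure P] {Ω' E : Type*} [MeasurableSpace Ω']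
    [MeasurableSpace E] {W : Ω → Ω'} {Z : Ω → E} (hW : Measurable W) (hZ : Measurable Z)
    (h : IndepFun W Z P) {G : Ω' × E → ℝ} (hG : Measurable G) {C : ℝ}
    (hint : ∀ z, Integrable (fun ω => G (W ω, z)) P) (hC : ∀ z, ∫ ω, |G (W ω, z)| ∂P ≤ C) :
    Integrable (fun ω => G (W ω, Z ω)) P ∧
      ∫ ω, G (W ω, Z ω) ∂P = ∫ z, ∫ ω, G (W ω, z) ∂P ∂(P.map Z) := by
  have hmap := (indepFun_iff_map_prod_eq_prod_map_map hW.aemeasurable hZ.aemeasurable).mp h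
  have : IsProbabilityMeasure (P.map W) := Measure.isProbabilityMeasure_map hW.aemeasurable
  have : IsProbabilityMeasure (P.map Z) := Measure.isProbabilityMeasure_map hZ.aemeasurable
  have hGz : ∀ z, Measurable fun w => G (w, z) := fun z => hG.comp (measurable_id.prodMk measurable_const)
  have hI : Integrable G ((P.map W).prod (P.map Z)) := by
    refine integrable_prod_of_integral_abs_le hG (C := C) (fun z => ?_) fun z => ?_
    · exact (integrable_map_measure (hGz z).aestronglyMeasurable hW.aemeasurable).mpr (hint z)
    · exact (integral_map hW.aemeasurable (hGz z).norm.aestronglyMeasurable).trans_le (hC z)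
  have hWZ : AEMeasurable (fun ω => (W ω, Z ω)) P := (hW.prodMk hZ).aemeasurable
  rw [← hmap] at hI
  refine ⟨(integrable_map_measure hG.aestronglyMeasurable hWZ).mp hI, ?_⟩
  rw [← integral_map (f := G) hWZ hG.aestronglyMeasurable]
  rw [hmap] at hI ⊢
  rw [integral_prod_symm _ hI]
  refine integral_congr_ae (.of_forall fun z => ?_)
  exact integral_map hW.aemeasurable (hGz z).aestronglyMeasurable

/-- A σ-field independent of `Z` is treated as a random variable: the identity of `Ω`, with `𝓖` on
the target. -/
lemma integrable_and_integral_comp_of_indep {Ω E : Type*} [mE : MeasurableSpace E]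
    {𝓖 : MeasurableSpace Ω} [mΩ : MeasurableSpace Ω] {P : Measure Ω} [IsProbabilityMeasure P]
    (h𝓖 : 𝓖 ≤ mΩ) {Z : Ω → E} (hZ : Measurable Z) (h : Indep 𝓖 (mE.comap Z) P)
    {G : Ω × E → ℝ} (hG : Measurable[𝓖.prod mE] G) {C : ℝ}
    (hint : ∀ z, Integrable (fun ω => G (ω, z)) P) (hC : ∀ z, ∫ ω, |G (ω, z)| ∂P ≤ C) :
    Integrable (fun ω => G (ω, Z ω)) P ∧
      ∫ ω, G (ω, Z ω) ∂P = ∫ z, ∫ ω, G (ω, z) ∂P ∂(P.map Z) := by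
  have hind : @IndepFun Ω Ω E mΩ 𝓖 mE id Z P := by
    refine (@IndepFun_iff_Indep Ω Ω E mΩ 𝓖 mE id Z P).mpr ?_
    rw [MeasurableSpace.comap_id]
    exact h
  exact @integrable_and_integral_comp_of_indepFun Ω mΩ P _ Ω E 𝓖 mE id Z
    (measurable_id'' h𝓖) hZ hind G hG C hint hC

lemma measurable_comp_swap_uncurry {Ω : Type*} {𝓖 : MeasurableSpace Ω} {B : ℝ≥0 → Ω → S2}
    (hc : ∀ ω, Continuous fun t => B t ω) (hm : ∀ t, Measurable (B t)) {f : S2 → ℝ}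
    (hf : Measurable f) : Measurable (fun p : Ω × ℝ≥0 => f (B p.2 p.1)) :=
  hf.comp ((measurable_uncurry_of_continuous_of_measurable hc hm).comp measurable_swap)

/-- Freezing D_t leaves the factor e^{-μ_l D_t}, whose mean is the Laplace transform. The σ-field
here is that of the whole path of `B`, over which continuity makes `B` jointly measurable. -/
lemma integral_zonal_timeChange {Ω : Type*} [MeasurableSpace Ω] {P : Measure Ω}
    [IsProbabilityMeasure P] {B : ℝ≥0 → Ω → S2} {D : ℝ≥0 → Ω → ℝ≥0} {Ψ : ℝ → ℝ} {x : S2}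
    (hB : IsRotationalBM B x P) (hD : IsSubordinator D P) (hΨ : HasLaplaceExponent D Ψ P)
    (hBD : IndepFun (fun ω t => B t ω) (fun ω t => D t ω) P) (l : ℕ) (v : S2) (t : ℝ≥0) :
    ∫ ω, zonal l (timeChange B D t ω) v ∂P =
      Real.exp (-t * Ψ (sphereEigenvalue l)) * zonal l x v := by
  have hind := (IndepFun_iff_Indep _ _ _).mp (hBD.comp measurable_id (measurable_pi_apply t))
  have hz : Measurable fun y => zonal l y v := (continuous_zonal_left l v).measurable
  have hint : ∀ s, Integrable (fun ω => zonal l (B s ω) v) P := fun s =>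
    Integrable.of_bound (hz.comp (hB.measurable s)).aestronglyMeasurable 1
      (.of_forall fun ω => abs_zonal_le_one l _ v)
  have hkey := (integrable_and_integral_comp_of_indep (C := 1)
    (measurable_pi_lambda (fun ω t => B t ω) hB.measurable).comap_le (hD.measurable t) hind
    (measurable_comp_swap_uncurry (𝓖 := MeasurableSpace.comap (fun ω t => B t ω) inferInstance)
      hB.continuous_paths (fun s => (measurable_pi_apply (X := fun _ => S2) s).comp
        (comap_measurable (fun ω t => B t ω))) hz) hint
    (fun s => by
      have := integral_mono (hint s).abs (integrable_const 1) fun ω => abs_zonal_le_one l (B s ω) v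
      simpa using this)).2
  simp only [integral_zonal_rotationalBM hB] at hkey
  simp only [timeChange]
  rw [hkey, integral_mul_const, ← hΨ t (sphereEigenvalue l)
    (by unfold sphereEigenvalue; positivity), integral_map (hD.measurable t).aemeasurable
    (by fun_prop)]

end BrownianMotion

/-! ### Separability in L² of the sections of a jointly measurable field. -/

section Separability

/-- Otherwise the balls of radius √ε/2 about uncountably many elements would be disjoint, which the
separable space L² forbids. -/
lemma exists_integral_sub_sq_lt_of_countablyGenerated {Ω ι : Type*} [MeasurableSpace Ω]
    [MeasurableSpace.CountablyGenerated Ω] (Q : Measure Ω) [IsFiniteMeasure Q] {A : Set ι}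
    (hA : ¬A.Countable) {f : ι → Ω → ℝ} (hf : ∀ i, MemLp (f i) 2 Q) {ε : ℝ} (hε : 0 < ε) :
    ∃ i ∈ A, ∃ j ∈ A, i ≠ j ∧ ∫ ω, (f i ω - f j ω) ^ 2 ∂Q < ε := by
  have : Fact ((2 : ENNReal) ≠ ⊤) := ⟨by norm_num⟩
  by_contra! h
  apply hA
  set F : ι → Lp ℝ 2 Q := fun i => (hf i).toLp (f i) with hF
  have hnorm : ∀ i j, ‖F i - F j‖ ^ 2 = ∫ ω, (f i ω - f j ω) ^ 2 ∂Q := by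
    intro i j
    rw [← real_inner_self_eq_norm_sq, L2.inner_def]
    refine integral_congr_ae ?_
    filter_upwards [Lp.coeFn_sub (F i) (F j), (hf i).coeFn_toLp, (hf j).coeFn_toLp]
      with ω h1 h2 h3
    rw [h1, Pi.sub_apply, h2, h3]
    simp [sq]
  have hdisj : A.PairwiseDisjoint fun i => Metric.ball (F i) (Real.sqrt ε / 2) := by
    intro i hi j hj hij
    refine Metric.ball_disjoint_ball ?_
    rw [add_halves, dist_eq_norm, ← Real.sqrt_sq (norm_nonneg (F i - F j)), hnorm]
    exact Real.sqrt_le_sqrt (h i hi j hj hij)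
  exact hdisj.countable_of_isOpen (fun _ _ => Metric.isOpen_ball)
    fun i _ => ⟨F i, Metric.mem_ball_self (by positivity)⟩

/-- A set in a product σ-field is built from countably many rectangles; their first sides generate
every section at once, whatever `a` is. -/
lemma exists_countable_generating_sections {Ω α : Type*} {m : MeasurableSpace Ω}
    {mα : MeasurableSpace α} {E : Set (Ω × α)} (hE : MeasurableSet E) :
    ∃ C : Set (Set Ω), C.Countable ∧ (∀ s ∈ C, MeasurableSet s) ∧
      ∀ a, MeasurableSet[MeasurableSpace.generateFrom C] {ω | (ω, a) ∈ E} := by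
  induction E, hE using MeasurableSpace.induction_on_inter generateFrom_prod.symm isPiSystem_prod with
  | empty => exact ⟨∅, Set.countable_empty, by simp, fun a => by simp⟩
  | basic t ht =>
    obtain ⟨s, hs, t, -, rfl⟩ := ht
    refine ⟨{s}, Set.countable_singleton _, by simpa using hs, fun a => ?_⟩
    by_cases ha : a ∈ t
    · simpa [ha] using MeasurableSpace.measurableSet_generateFrom (Set.mem_singleton s)
    · simp [ha]
  | compl t _ ih =>
    obtain ⟨C, hC, hCm, h⟩ := ih
    exact ⟨C, hC, hCm, fun a => (h a).compl⟩
  | iUnion f _ _ ih =>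
    choose C hC hCm h using ih
    refine ⟨⋃ n, C n, Set.countable_iUnion hC, fun s hs => ?_, fun a => ?_⟩
    · obtain ⟨n, hn⟩ := Set.mem_iUnion.mp hs
      exact hCm n s hn
    · simp only [Set.mem_iUnion, Set.ofPred_exists]
      exact MeasurableSet.iUnion fun n =>
        MeasurableSpace.generateFrom_mono (Set.subset_iUnion C n) _ (h n a)

lemma exists_countablyGenerated_sections {Ω α : Type*} {m : MeasurableSpace Ω}
    {mα : MeasurableSpace α} {f : Ω × α → ℝ} (hf : Measurable f) :
    ∃ C : Set (Set Ω), C.Countable ∧ (∀ s ∈ C, MeasurableSet s) ∧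
      ∀ a, Measurable[MeasurableSpace.generateFrom C] fun ω => f (ω, a) := by
  choose C hC hCm h using fun q : ℚ => exists_countable_generating_sections
    (hf (measurableSet_Iio (a := (q : ℝ))))
  refine ⟨⋃ q, C q, Set.countable_iUnion hC, fun s hs => ?_, fun a => ?_⟩
  · obtain ⟨q, hq⟩ := Set.mem_iUnion.mp hs
    exact hCm q s hq
  · rw [BorelSpace.measurable_eq (α := ℝ), Real.borel_eq_generateFrom_Iio_rat]
    refine @measurable_generateFrom _ _ (MeasurableSpace.generateFrom (⋃ q, C q)) _ _ fun t ht => ?_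
    obtain ⟨q, rfl⟩ := Set.mem_iUnion.mp ht
    exact MeasurableSpace.generateFrom_mono (Set.subset_iUnion C q) _ (h q a)

/-- Among the sections of a jointly measurable square-integrable field, indexed by an uncountable
set, there are two that are close in mean square. -/
lemma exists_integral_sub_sq_lt {Ω α : Type*} [m : MeasurableSpace Ω] {mα : MeasurableSpace α}
    (P : Measure Ω) [IsFiniteMeasure P] {A : Set α} (hA : ¬A.Countable) {f : α → Ω → ℝ}
    (hf : ∀ i, MemLp (f i) 2 P) (hm : Measurable fun p : Ω × α => f p.2 p.1) {ε : ℝ}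
    (hε : 0 < ε) :
    ∃ i ∈ A, ∃ j ∈ A, i ≠ j ∧ ∫ ω, (f i ω - f j ω) ^ 2 ∂P < ε := by
  -- `Ω` itself need not be countably generated; it is enough that all sections live on one
  -- countably generated σ-field, to which `P` is restricted.
  obtain ⟨C, hC, hCm, h⟩ := exists_countablyGenerated_sections hm
  have hle : MeasurableSpace.generateFrom C ≤ m := MeasurableSpace.generateFrom_le hCm
  have hcg : @MeasurableSpace.CountablyGenerated Ω (MeasurableSpace.generateFrom C) :=
    @MeasurableSpace.CountablyGenerated.mk Ω (MeasurableSpace.generateFrom C) ⟨C, hC, rfl⟩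
  have hsm : ∀ i, StronglyMeasurable[MeasurableSpace.generateFrom C] (f i) := fun i =>
    (h i).stronglyMeasurable
  have hL : ∀ i, MemLp (f i) 2 (P.trim hle) := fun i =>
    ⟨(hsm i).aestronglyMeasurable, by rw [eLpNorm_trim hle (hsm i)]; exact (hf i).2⟩
  obtain ⟨i, hi, j, hj, hij, hlt⟩ :=
    @exists_integral_sub_sq_lt_of_countablyGenerated Ω α (MeasurableSpace.generateFrom C) hcg
      (P.trim hle) _ A hA f hL ε hε
  refine ⟨i, hi, j, hj, hij, ?_⟩
  exact (integral_trim hle (((hsm i).sub (hsm j)).pow 2)).trans_lt hlt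

end Separability

/-! ### Continuity of the covariance of an isotropic measurable field. -/

section Covariance

/-- The covariance function of a centred random field. -/
noncomputable def fieldCovariance {Ω : Type*} [MeasurableSpace Ω] (T : S2 → Ω → ℝ)
    (P : Measure Ω) (u v : S2) : ℝ :=
  ∫ ω, T u ω * T v ω ∂P

variable {Ω : Type*} [MeasurableSpace Ω] {P : Measure Ω} {T : S2 → Ω → ℝ}

lemma IsIsotropicGaussianField.memLp (hT : IsIsotropicGaussianField T P) (x : S2) :
    MemLp (T x) 2 P :=
  (hT.gaussian.hasGaussianLaw_eval x).memLp_two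

lemma IsIsotropicGaussianField.integrable_mul (hT : IsIsotropicGaussianField T P) (x y : S2) :
    Integrable (fun ω => T x ω * T y ω) P :=
  (hT.memLp x).integrable_mul (hT.memLp y)

lemma IsIsotropicGaussianField.fieldCovariance_congr (hT : IsIsotropicGaussianField T P)
    {u v u' v' : S2} (h : inner ℝ (u : E3) (v : E3) = inner ℝ (u' : E3) (v' : E3)) :
    fieldCovariance T P u v = fieldCovariance T P u' v' := by
  obtain ⟨g, hg, hu, hv⟩ := exists_rotation_pair u v u' v' h
  have := ((hT.isotropic g hg).comp (u := fun f : S2 → ℝ => f u * f v)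
    (by fun_prop)).integral_eq
  simp only [Function.comp_def, hu, hv] at this
  exact this.symm

/-- The covariance of an isotropic field as a function of the inner product. -/
noncomputable def covarianceKernel (T : S2 → Ω → ℝ) (P : Measure Ω) (t : ℝ) : ℝ :=
  fieldCovariance T P northPole (meridian t)

lemma IsIsotropicGaussianField.fieldCovariance_eq_kernel (hT : IsIsotropicGaussianField T P)
    (u v : S2) : fieldCovariance T P u v = covarianceKernel T P (inner ℝ (u : E3) (v : E3)) :=
  hT.fieldCovariance_congr (inner_northPole_meridian (inner_mem_Icc u v)).symm

lemma IsIsotropicGaussianField.integral_sub_sq (hT : IsIsotropicGaussianField T P)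
    (u v : S2) : ∫ ω, (T u ω - T v ω) ^ 2 ∂P =
      2 * covarianceKernel T P 1 - 2 * fieldCovariance T P u v := by
  have e : ∀ ω, (T u ω - T v ω) ^ 2 =
      (T u ω * T u ω + T v ω * T v ω) - 2 * (T u ω * T v ω) := fun ω => by ring
  simp only [e]
  have hadd : Integrable (fun ω => T u ω * T u ω + T v ω * T v ω) P :=
    (hT.integrable_mul u u).add (hT.integrable_mul v v)
  rw [integral_sub hadd
    ((hT.integrable_mul u v).const_mul 2), integral_add (hT.integrable_mul u u)
    (hT.integrable_mul v v), integral_const_mul]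
  change fieldCovariance T P u u + fieldCovariance T P v v - 2 * fieldCovariance T P u v = _
  rw [hT.fieldCovariance_eq_kernel u u, hT.fieldCovariance_eq_kernel v v, inner_self_S2,
    inner_self_S2]
  ring

lemma IsIsotropicGaussianField.integrable_sub_sq (hT : IsIsotropicGaussianField T P)
    (u v : S2) : Integrable (fun ω => (T u ω - T v ω) ^ 2) P :=
  ((hT.memLp u).sub (hT.memLp v)).integrable_sq

lemma IsIsotropicGaussianField.integral_sub_sq_le (hT : IsIsotropicGaussianField T P)
    (u v w : S2) : ∫ ω, (T u ω - T v ω) ^ 2 ∂P ≤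
      2 * ∫ ω, (T u ω - T w ω) ^ 2 ∂P + 2 * ∫ ω, (T v ω - T w ω) ^ 2 ∂P := by
  rw [← integral_const_mul, ← integral_const_mul, ← integral_add
    ((hT.integrable_sub_sq u w).const_mul 2) ((hT.integrable_sub_sq v w).const_mul 2)]
  refine integral_mono (hT.integrable_sub_sq u v) (((hT.integrable_sub_sq u w).const_mul 2).add
    ((hT.integrable_sub_sq v w).const_mul 2)) fun ω => ?_
  simp only
  nlinarith [sq_nonneg (T u ω + T v ω - 2 * T w ω)]

/-- Points less than 2θ apart have a common neighbour at angle exactly θ, with s = cos θ. The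
coefficient of u + v fixes the inner products and `β`, along the normal, fixes the norm. -/
lemma exists_equidistant (u v : S2) {s : ℝ}
    (hs : 2 * s ^ 2 < 1 + inner ℝ (u : E3) (v : E3)) :
    ∃ w : S2, inner ℝ (u : E3) (w : E3) = s ∧ inner ℝ (v : E3) (w : E3) = s := by
  set t := inner ℝ (u : E3) (v : E3) with ht
  obtain ⟨n, hn, hn0⟩ := exists_ne_zero_orthogonal (u : E3) v
  have hun : inner ℝ (u : E3) n = 0 := hn u (Submodule.subset_span (by simp))
  have hvn : inner ℝ (v : E3) n = 0 := hn v (Submodule.subset_span (by simp))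
  have hnn : ‖n‖ ≠ 0 := norm_ne_zero_iff.mpr hn0
  have ht1 : 0 < 1 + t := by nlinarith [sq_nonneg s]
  have hvu : inner ℝ (v : E3) (u : E3) = t := real_inner_comm _ _
  have hβ : 0 ≤ 1 - 2 * s ^ 2 / (1 + t) := by
    rw [sub_nonneg, div_le_one ht1]; exact hs.le
  set β := Real.sqrt (1 - 2 * s ^ 2 / (1 + t))
  have hβ2 : β ^ 2 = 1 - 2 * s ^ 2 / (1 + t) := Real.sq_sqrt hβ
  set w : E3 := (s / (1 + t)) • ((u : E3) + v) + (β / ‖n‖) • n with hw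
  have hwn : ‖w‖ = 1 := by
    rw [← sq_eq_sq₀ (norm_nonneg _) zero_le_one, one_pow, ← real_inner_self_eq_norm_sq, hw]
    simp only [inner_add_left, inner_add_right, real_inner_smul_left, real_inner_smul_right,
      inner_self_S2, hvu, ← ht, hun, hvn, real_inner_comm (u : E3) n, real_inner_comm (v : E3) n,
      real_inner_self_eq_norm_sq n]
    have e : β / ‖n‖ * (β / ‖n‖ * ‖n‖ ^ 2) = β ^ 2 := by field_simp
    rw [e, hβ2]
    field_simp
    ring
  refine ⟨⟨w, by simpa using hwn⟩, ?_, ?_⟩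
  · simp only [hw, inner_add_right, real_inner_smul_right, inner_self_S2, ← ht, hun]
    field_simp
    ring
  · simp only [hw, inner_add_right, real_inner_smul_right, inner_self_S2, hvu, hvn]
    field_simp
    ring

lemma not_countable_meridian : ¬(meridian '' Set.Icc 0 1).Countable := by
  have hinj : Set.InjOn meridian (Set.Icc 0 1) := by
    intro s hs t ht h
    rw [← inner_northPole_meridian (t := s) ⟨by linarith [hs.1], hs.2⟩, h,
      inner_northPole_meridian (t := t) ⟨by linarith [ht.1], ht.2⟩]
  intro h
  have := Cardinal.Real.Icc_countable_iff.mp (Set.countable_of_injective_of_countable_image hinj h)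
  exact this.not_gt one_pos

/-- Separability yields one pair of distinct points with mean-square distance below ε/4, and
isotropy transfers the bound to every pair at that angle. Closer points are compared through an
equidistant third one. -/
lemma IsIsotropicGaussianField.exists_delta (hT : IsIsotropicGaussianField T P)
    (hm : Measurable fun p : Ω × S2 => T p.2 p.1) {ε : ℝ} (hε : 0 < ε) :
    ∃ s : ℝ, s < 1 ∧ ∀ u v : S2, s < inner ℝ (u : E3) (v : E3) →
      ∫ ω, (T u ω - T v ω) ^ 2 ∂P < ε := by
  have := hT.gaussian.isProbabilityMeasure
  obtain ⟨u₀, ⟨a, ha, rfl⟩, v₀, ⟨b, hb, rfl⟩, hne, hlt⟩ := exists_integral_sub_sq_lt P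
    not_countable_meridian hT.memLp hm (show 0 < ε / 4 by positivity)
  set s := inner ℝ (meridian a : E3) (meridian b : E3) with hs
  have ha' : a ∈ Set.Icc (-1 : ℝ) 1 := ⟨by linarith [ha.1], ha.2⟩
  have hb' : b ∈ Set.Icc (-1 : ℝ) 1 := ⟨by linarith [hb.1], hb.2⟩
  -- This is why the points are taken at heights in [0, 1]: with 0 ≤ s < 1 the threshold 2s² - 1,
  -- the cosine of twice the angle, is below 1.
  have hs0 : 0 ≤ s := by
    rw [hs, inner_meridian hb']
    simp only [meridian]
    have : 0 ≤ Real.sin (Real.arccos a) := by rw [Real.sin_arccos]; positivity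
    simp [Real.cos_arccos ha'.1 ha'.2]
    have := ha.1
    have := hb.1
    positivity
  have hs1 : s < 1 := by
    refine lt_of_le_of_ne (inner_mem_Icc _ _).2 fun h => hne ?_
    exact Subtype.ext ((inner_eq_one_iff_of_norm_eq_one (norm_coe_S2 _) (norm_coe_S2 _)).mp h)
  refine ⟨2 * s ^ 2 - 1, by nlinarith, fun u v huv => ?_⟩
  obtain ⟨w, hu, hv⟩ := exists_equidistant u v (s := s) (by linarith)
  have h1 := hT.integral_sub_sq_le u v w
  have h2 : ∀ z : S2, inner ℝ (z : E3) (w : E3) = s →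
      ∫ ω, (T z ω - T w ω) ^ 2 ∂P < ε / 4 := fun z hz => by
    rw [hT.integral_sub_sq] at hlt ⊢
    rwa [hT.fieldCovariance_congr (hz.trans hs)]
  linarith [h2 u hu, h2 v hv]

lemma IsIsotropicGaussianField.continuous_covarianceKernel (hT : IsIsotropicGaussianField T P)
    (hm : Measurable fun p : Ω × S2 => T p.2 p.1) : Continuous (covarianceKernel T P) := by
  rw [Metric.continuous_iff']
  intro t ε hε
  -- Adding 1 keeps `σ` positive even for a field of variance zero.
  set σ := covarianceKernel T P 1 + 1 with hσ
  have hσ0 : 0 < σ := by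
    have h1 := hT.fieldCovariance_eq_kernel northPole northPole
    rw [inner_self_S2] at h1
    have h2 : 0 ≤ fieldCovariance T P northPole northPole :=
      integral_nonneg fun ω => mul_self_nonneg _
    linarith
  obtain ⟨s, hs, hsv⟩ := hT.exists_delta hm (show 0 < ε ^ 2 / σ by positivity)
  have hcont : Continuous fun r => inner ℝ (meridian r : E3) (meridian t : E3) :=
    (continuous_subtype_val.comp continuous_meridian).inner continuous_const
  have hev : ∀ᶠ r in 𝓝 t, s < inner ℝ (meridian r : E3) (meridian t : E3) :=
    hcont.continuousAt.eventually_const_lt (hs.trans_eq (inner_self_S2 _).symm)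
  filter_upwards [hev] with r hr
  have hd := hsv _ _ hr
  rw [Real.dist_eq]
  simp only [covarianceKernel, fieldCovariance]
  rw [← integral_sub (hT.integrable_mul _ _) (hT.integrable_mul _ _)]
  have hsq : ∫ ω, T northPole ω * T northPole ω ∂P = σ - 1 := by
    have h1 := hT.fieldCovariance_eq_kernel northPole northPole
    rw [inner_self_S2] at h1
    rw [← fieldCovariance, h1, hσ]
    ring
  -- The weights of this form of Cauchy–Schwarz are chosen so that each of the two terms is below
  -- ε/2.
  have hI1 := (hT.integrable_mul northPole northPole).const_mul (ε / (2 * σ))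
  have hI2 := (hT.integrable_sub_sq (meridian r) (meridian t)).const_mul (σ / (2 * ε))
  calc |∫ ω, (T northPole ω * T (meridian r) ω - T northPole ω * T (meridian t) ω) ∂P|
      ≤ ∫ ω, (ε / (2 * σ) * (T northPole ω * T northPole ω) +
          σ / (2 * ε) * (T (meridian r) ω - T (meridian t) ω) ^ 2) ∂P := by
        refine abs_integral_le_integral_abs.trans (integral_mono
          ((hT.integrable_mul _ _).sub (hT.integrable_mul _ _)).abs (hI1.add hI2) fun ω => ?_)
        simp only
        rw [← mul_sub, abs_mul]
        have := two_mul_le_add_sq (ε / σ * |T northPole ω|) |T (meridian r) ω - T (meridian t) ω|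
        rw [mul_pow, sq_abs, sq_abs] at this
        have h2 := mul_le_mul_of_nonneg_left this (show 0 ≤ σ / (2 * ε) by positivity)
        calc _ = σ / (2 * ε) * (2 * (ε / σ * |T northPole ω|) *
              |T (meridian r) ω - T (meridian t) ω|) := by field_simp
          _ ≤ _ := h2
          _ = _ := by field_simp
    _ = ε / (2 * σ) * (σ - 1) + σ / (2 * ε) *
          ∫ ω, (T (meridian r) ω - T (meridian t) ω) ^ 2 ∂P := by
        rw [integral_add hI1 hI2, integral_const_mul, integral_const_mul, hsq]
    _ < ε / (2 * σ) * σ + σ / (2 * ε) * (ε ^ 2 / σ) := by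
        refine add_lt_add ?_ ?_
        · exact mul_lt_mul_of_pos_left (by linarith) (by positivity)
        · exact mul_lt_mul_of_pos_left hd (by positivity)
    _ = ε := by field_simp; ring

end Covariance

/-! ### The angular power spectrum and the spectral expansion of the covariance. -/

section Spectrum

variable {Ω : Type*} [MeasurableSpace Ω] {P : Measure Ω} {T : S2 → Ω → ℝ}

lemma measurable_field_mul {Ω : Type*} [MeasurableSpace Ω] {T : S2 → Ω → ℝ}
    (h : Measurable fun p : Ω × S2 => T p.2 p.1) :
    Measurable fun p : Ω × (S2 × S2) => T p.2.1 p.1 * T p.2.2 p.1 :=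
  (h.comp (measurable_fst.prodMk (measurable_fst.comp measurable_snd))).mul
    (h.comp (measurable_fst.prodMk (measurable_snd.comp measurable_snd)))

lemma IsIsotropicGaussianField.integral_sq (hT : IsIsotropicGaussianField T P) (u : S2) :
    ∫ ω, T u ω * T u ω ∂P = covarianceKernel T P 1 := by
  rw [← inner_self_S2 u, ← hT.fieldCovariance_eq_kernel]
  rfl

lemma IsIsotropicGaussianField.integral_abs_mul_le (hT : IsIsotropicGaussianField T P)
    (u v : S2) : ∫ ω, |T u ω * T v ω| ∂P ≤ covarianceKernel T P 1 := by
  calc ∫ ω, |T u ω * T v ω| ∂P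
      ≤ ∫ ω, (1 / 2 * (T u ω * T u ω) + 1 / 2 * (T v ω * T v ω)) ∂P := by
        refine integral_mono (hT.integrable_mul u v).abs (((hT.integrable_mul u u).const_mul _).add
          ((hT.integrable_mul v v).const_mul _)) fun ω => ?_
        simp only
        rw [abs_le]
        constructor <;> nlinarith [sq_nonneg (T u ω + T v ω), sq_nonneg (T u ω - T v ω)]
    _ = covarianceKernel T P 1 := by
        rw [integral_add ((hT.integrable_mul u u).const_mul _)
          ((hT.integrable_mul v v).const_mul _), integral_const_mul, integral_const_mul,
          hT.integral_sq, hT.integral_sq]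
        ring

lemma IsIsotropicGaussianField.covarianceKernel_one_nonneg (hT : IsIsotropicGaussianField T P) :
    0 ≤ covarianceKernel T P 1 := by
  rw [← hT.integral_sq northPole]
  exact integral_nonneg fun _ => mul_self_nonneg _

/-- Weighted mean-square integrals of the field: the product of the values at two points is
integrable over the product of the probability space and any finite measure space of pairs. -/
lemma IsIsotropicGaussianField.integrable_prod (hT : IsIsotropicGaussianField T P)
    (hm : Measurable fun p : Ω × S2 => T p.2 p.1) {w : S2 × S2 → ℝ} (hw : Continuous w)
    (ν : Measure (S2 × S2)) [IsFiniteMeasure ν] :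
    Integrable (fun p : Ω × (S2 × S2) => T p.2.1 p.1 * T p.2.2 p.1 * w p.2) (P.prod ν) := by
  have := hT.gaussian.isProbabilityMeasure
  obtain ⟨M, hM⟩ := isCompact_univ.exists_bound_of_continuousOn hw.continuousOn
  refine integrable_prod_of_integral_abs_le (C := covarianceKernel T P 1 * M)
    ((measurable_field_mul hm).mul (hw.measurable.comp measurable_snd))
    (fun z => (hT.integrable_mul z.1 z.2).mul_const (w z)) fun z => ?_
  simp only [abs_mul _ (w z), integral_mul_const]
  exact mul_le_mul (hT.integral_abs_mul_le _ _) (hM z trivial) (abs_nonneg _)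
    hT.covarianceKernel_one_nonneg

/-- A general `ν` covers both the double surface integral and, through the image of y ↦ (n, y), an
integral with one point fixed. -/
lemma IsIsotropicGaussianField.integral_weighted (hT : IsIsotropicGaussianField T P)
    (hm : Measurable fun p : Ω × S2 => T p.2 p.1) {w : S2 × S2 → ℝ} (hw : Continuous w)
    (ν : Measure (S2 × S2)) [IsFiniteMeasure ν] :
    Integrable (fun ω => ∫ z, T z.1 ω * T z.2 ω * w z ∂ν) P ∧
      ∫ ω, ∫ z, T z.1 ω * T z.2 ω * w z ∂ν ∂P =
        ∫ z, covarianceKernel T P (inner ℝ (z.1 : E3) (z.2 : E3)) * w z ∂ν := by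
  have := hT.gaussian.isProbabilityMeasure
  have hI := hT.integrable_prod hm hw ν
  refine ⟨hI.integral_prod_left, ?_⟩
  rw [integral_integral_swap hI]
  refine integral_congr_ae (.of_forall fun z => ?_)
  simp only [integral_mul_const, ← hT.fieldCovariance_eq_kernel]
  rfl

lemma IsIsotropicGaussianField.integral_sq_weighted (hT : IsIsotropicGaussianField T P)
    (hm : Measurable fun p : Ω × S2 => T p.2 p.1) {φ : S2 → ℝ} (hφ : Continuous φ) :
    Integrable (fun ω => (∫ x, T x ω * φ x ∂sphereMeasure) ^ 2) P ∧
      ∫ ω, (∫ x, T x ω * φ x ∂sphereMeasure) ^ 2 ∂P =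
        ∫ x, φ x * ∫ y, covarianceKernel T P (inner ℝ (x : E3) (y : E3)) * φ y
          ∂sphereMeasure ∂sphereMeasure := by
  have e : ∀ ω, (∫ x, T x ω * φ x ∂sphereMeasure) ^ 2 =
      ∫ z : S2 × S2, T z.1 ω * T z.2 ω * (φ z.1 * φ z.2) ∂(sphereMeasure.prod sphereMeasure) := by
    intro ω
    rw [sq, ← integral_prod_mul]
    refine integral_congr_ae (.of_forall fun z => ?_)
    simp only
    ring
  simp only [e]
  have hw : Continuous fun z : S2 × S2 => φ z.1 * φ z.2 := by fun_prop
  obtain ⟨h1, h2⟩ := hT.integral_weighted hm hw (sphereMeasure.prod sphereMeasure)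
  refine ⟨h1, h2.trans ?_⟩
  have hκ := hT.continuous_covarianceKernel hm
  rw [MeasureTheory.integral_prod]
  · refine integral_congr_ae (.of_forall fun x => ?_)
    simp only
    rw [← integral_const_mul]
    refine integral_congr_ae (.of_forall fun y => ?_)
    simp only
    ring
  · refine Continuous.integrable_of_hasCompactSupport ?_ (HasCompactSupport.of_compactSpace _)
    fun_prop

lemma IsIsotropicGaussianField.integral_mul_weighted (hT : IsIsotropicGaussianField T P)
    (hm : Measurable fun p : Ω × S2 => T p.2 p.1) {φ : S2 → ℝ} (hφ : Continuous φ) (n : S2) :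
    Integrable (fun ω => T n ω * ∫ x, T x ω * φ x ∂sphereMeasure) P ∧
      ∫ ω, T n ω * ∫ x, T x ω * φ x ∂sphereMeasure ∂P =
        ∫ y, covarianceKernel T P (inner ℝ (n : E3) (y : E3)) * φ y ∂sphereMeasure := by
  have hmap : ∀ f : S2 × S2 → ℝ, ∫ z, f z ∂(sphereMeasure.map fun y => (n, y)) =
      ∫ y, f (n, y) ∂sphereMeasure := fun f =>
    (measurableEmbedding_prodMk_left n).integral_map f
  obtain ⟨h1, h2⟩ := hT.integral_weighted hm (w := fun z => φ z.2) (by fun_prop)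
    (sphereMeasure.map fun y => (n, y))
  simp only [hmap, mul_assoc, integral_const_mul] at h1 h2
  exact ⟨h1, h2⟩

lemma sphericalHarmonic_zero (l : ℕ) (x : S2) : sphericalHarmonic l 0 x =
    ((Real.sqrt ((2 * l + 1) / (4 * Real.pi)) * zonal l northPole x : ℝ) : ℂ) := by
  have : (l.factorial : ℝ) ≠ 0 := Nat.cast_ne_zero.mpr l.factorial_ne_zero
  rw [zonal, inner_northPole]
  simp [sphericalHarmonic, sphericalHarmonicNat, assocLegendreQ, this]

lemma norm_randomFourierCoeff_zero_sq {Ω : Type*} (T : S2 → Ω → ℝ) (l : ℕ) (ω : Ω) :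
    ‖randomFourierCoeff T l 0 ω‖ ^ 2 = (2 * l + 1) / (4 * Real.pi) *
      (∫ x, T x ω * zonal l northPole x ∂sphereMeasure) ^ 2 := by
  have e : randomFourierCoeff T l 0 ω = ((Real.sqrt ((2 * l + 1) / (4 * Real.pi)) *
      ∫ x, T x ω * zonal l northPole x ∂sphereMeasure : ℝ) : ℂ) := by
    rw [randomFourierCoeff, ← integral_const_mul, ← integral_complex_ofReal]
    refine integral_congr_ae (.of_forall fun x => ?_)
    simp only [sphericalHarmonic_zero, Complex.conj_ofReal]
    push_cast
    ring
  rw [e, Complex.norm_real, Real.norm_eq_abs, sq_abs, mul_pow, Real.sq_sqrt (by positivity)]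

/-- C_l is the Funk–Hecke eigenvalue of the covariance: in the double integral for E|a_{l0}|² the
factor (2l+1)/(4π) cancels the squared norm of the zonal function. -/
lemma IsIsotropicGaussianField.integral_kernel_mul_zonal_self (hT : IsIsotropicGaussianField T P)
    (hm : Measurable fun p : Ω × S2 => T p.2 p.1) (l : ℕ) (x y : S2) :
    ∫ u : S2, covarianceKernel T P (inner ℝ (x : E3) (u : E3)) * zonal l y u ∂sphereMeasure =
      angularPowerSpectrum T P l * zonal l x y := by
  have hκ := hT.continuous_covarianceKernel hm
  have hc : angularPowerSpectrum T P l = ∫ u : S2, covarianceKernel T P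
      (inner ℝ (northPole : E3) (u : E3)) * zonal l northPole u ∂sphereMeasure := by
    simp only [angularPowerSpectrum, norm_randomFourierCoeff_zero_sq]
    rw [integral_const_mul, (hT.integral_sq_weighted hm (continuous_zonal_right l northPole)).2]
    have e : ∀ x, zonal l northPole x * ∫ y, covarianceKernel T P (inner ℝ (x : E3) (y : E3)) *
        zonal l northPole y ∂sphereMeasure = (∫ u : S2, covarianceKernel T P
          (inner ℝ (northPole : E3) (u : E3)) * zonal l northPole u ∂sphereMeasure) *
        (zonal l northPole x * zonal l northPole x) := by
      intro x
      have := integral_kernel_mul_zonal _ hκ l x northPole northPole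
      simp only [zonal_comm l _ northPole] at this
      rw [this]
      ring
    simp only [e, integral_const_mul, integral_zonal_mul_self]
    field_simp
  rw [hc, ← integral_kernel_mul_zonal _ hκ l x y northPole]
  simp only [zonal_comm l y]

lemma angularPowerSpectrum_nonneg (T : S2 → Ω → ℝ) (P : Measure Ω) (l : ℕ) :
    0 ≤ angularPowerSpectrum T P l := integral_nonneg fun _ => by positivity

/-- The variance of the `l`-th frequency component. -/
noncomputable def frequencyVariance (T : S2 → Ω → ℝ) (P : Measure Ω) (l : ℕ) : ℝ :=
  (2 * l + 1) / (4 * Real.pi) * angularPowerSpectrum T P l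

lemma frequencyVariance_nonneg (T : S2 → Ω → ℝ) (P : Measure Ω) (l : ℕ) :
    0 ≤ frequencyVariance T P l := mul_nonneg (by positivity) (angularPowerSpectrum_nonneg T P l)

lemma frequencyCovariance_eq (T : S2 → Ω → ℝ) (P : Measure Ω) (x y : S2) (l : ℕ) :
    frequencyCovariance T P x y l = frequencyVariance T P l * zonal l x y := rfl

/-- A Bessel inequality: the partial sums of the spectral series are at most the variance. -/
lemma IsIsotropicGaussianField.sum_frequencyVariance_le (hT : IsIsotropicGaussianField T P)
    (hm : Measurable fun p : Ω × S2 => T p.2 p.1) (N : ℕ) :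
    ∑ l ∈ Finset.range N, frequencyVariance T P l ≤ covarianceKernel T P 1 := by
  have hκ := hT.continuous_covarianceKernel hm
  set n := northPole
  -- `φ` is the truncated reproducing kernel at `n`, so ∫Tφ is the projection of the field, at `n`,
  -- on degrees below `N`. Its second moment and its covariance with T(n) both equal the partial
  -- sum, and the mean-square error is nonnegative.
  set φ : S2 → ℝ := fun u => ∑ l ∈ Finset.range N, (2 * l + 1) / (4 * Real.pi) * zonal l n u with hφ
  have hφc : Continuous φ := by fun_prop
  have hconv : ∀ x : S2, ∫ y, covarianceKernel T P (inner ℝ (x : E3) (y : E3)) * φ y ∂sphereMeasure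
      = ∑ l ∈ Finset.range N, frequencyVariance T P l * zonal l x n := by
    intro x
    simp only [hφ, Finset.mul_sum, mul_left_comm (covarianceKernel T P _)]
    rw [integral_finsetSum _ fun l _ => integrable_of_continuous (by fun_prop)]
    refine Finset.sum_congr rfl fun l _ => ?_
    rw [integral_const_mul, hT.integral_kernel_mul_zonal_self hm, frequencyVariance, mul_assoc]
  obtain ⟨hi1, h1⟩ := hT.integral_sq_weighted hm hφc
  obtain ⟨hi2, h2⟩ := hT.integral_mul_weighted hm hφc n
  rw [hconv] at h2
  simp only [zonal_self, mul_one] at h2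
  have h3 : ∫ x, φ x * ∫ y, covarianceKernel T P (inner ℝ (x : E3) (y : E3)) * φ y
      ∂sphereMeasure ∂sphereMeasure = ∑ l ∈ Finset.range N, frequencyVariance T P l := by
    simp only [hconv, Finset.mul_sum]
    rw [integral_finsetSum _ fun l _ => integrable_of_continuous (by fun_prop)]
    refine Finset.sum_congr rfl fun l hl => ?_
    simp only [hφ, Finset.sum_mul]
    rw [integral_finsetSum _ fun l _ => integrable_of_continuous (by fun_prop)]
    simp only [mul_mul_mul_comm _ (zonal _ n _), integral_const_mul, integral_zonal_mul_zonal]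
    rw [Finset.sum_eq_single l]
    · simp only [if_true, zonal_self]
      field_simp
    · intro k _ hk
      simp [hk]
    · exact fun h => absurd hl h
  rw [h3] at h1
  have hpos : 0 ≤ ∫ ω, (T n ω - ∫ x, T x ω * φ x ∂sphereMeasure) ^ 2 ∂P :=
    integral_nonneg fun _ => sq_nonneg _
  have e : ∀ ω, (T n ω - ∫ x, T x ω * φ x ∂sphereMeasure) ^ 2 =
      (T n ω * T n ω + (∫ x, T x ω * φ x ∂sphereMeasure) ^ 2) -
        2 * (T n ω * ∫ x, T x ω * φ x ∂sphereMeasure) := fun ω => by ring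
  simp only [e] at hpos
  have hi3 : Integrable (fun ω => T n ω * T n ω + (∫ x, T x ω * φ x ∂sphereMeasure) ^ 2) P :=
    (hT.integrable_mul n n).add hi1
  rw [integral_sub hi3 (hi2.const_mul 2), integral_add (hT.integrable_mul n n) hi1,
    integral_const_mul, h1, h2, hT.integral_sq] at hpos
  linarith

lemma IsIsotropicGaussianField.summable_frequencyVariance (hT : IsIsotropicGaussianField T P)
    (hm : Measurable fun p : Ω × S2 => T p.2 p.1) : Summable (frequencyVariance T P) :=
  summable_of_sum_range_le (frequencyVariance_nonneg T P) (hT.sum_frequencyVariance_le hm)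

lemma abs_eval_legendreQ_le {t : ℝ} (ht : t ∈ Set.Icc (-1 : ℝ) 1) (l : ℕ) :
    |(legendreQ l).eval t| ≤ 1 := by
  have := abs_zonal_le_one l northPole (meridian t)
  rwa [zonal, inner_northPole_meridian ht] at this

/-- A continuous zonal function orthogonal to all Legendre polynomials vanishes. -/
lemma eq_zero_of_integral_mul_zonal {d : ℝ → ℝ} (hd : ContinuousOn d (Set.Icc (-1) 1)) (x : S2)
    (h : ∀ l, ∫ y : S2, d (inner ℝ (x : E3) (y : E3)) * zonal l x y ∂sphereMeasure = 0) (y : S2) :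
    d (inner ℝ (x : E3) (y : E3)) = 0 := by
  set D : S2 → ℝ := fun y => d (inner ℝ (x : E3) (y : E3)) with hD
  have hDc : Continuous D :=
    hd.comp_continuous (by fun_prop) (inner_mem_Icc x)
  have hp : ∀ p : Polynomial ℝ, ∫ y : S2, D y * p.eval (inner ℝ (x : E3) (y : E3)) ∂sphereMeasure
      = 0 := by
    intro p
    refine legendreQ_induction (M := fun p => ∫ y : S2, D y * p.eval (inner ℝ (x : E3) (y : E3))
      ∂sphereMeasure = 0) (fun p q hp hq => ?_) (fun c p hp => ?_) h p
    · simp only [Polynomial.eval_add, mul_add]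
      rw [integral_add (integrable_of_continuous (by fun_prop))
        (integrable_of_continuous (by fun_prop)), hp, hq, add_zero]
    · simp only [Polynomial.eval_mul, Polynomial.eval_C, mul_left_comm _ c]
      rw [integral_const_mul, hp, mul_zero]
  -- As `D` is orthogonal to all zonal polynomials, ∫D² = ∫D(D - p), which Weierstrass approximation
  -- makes arbitrarily small.
  have hsq : ∫ y : S2, D y ^ 2 ∂sphereMeasure = 0 := by
    refine le_antisymm (le_of_forall_pos_le_add fun ε hε => ?_) (integral_nonneg fun _ => sq_nonneg _)
    set A := ∫ y : S2, |D y| ∂sphereMeasure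
    have hA : 0 ≤ A := integral_nonneg fun _ => abs_nonneg _
    obtain ⟨p, hpd⟩ := exists_polynomial_near_of_continuousOn (-1) 1 d hd (ε / (A + 1))
      (by positivity)
    calc ∫ y : S2, D y ^ 2 ∂sphereMeasure
        = ∫ y : S2, D y * (D y - p.eval (inner ℝ (x : E3) (y : E3))) ∂sphereMeasure := by
          simp only [mul_sub]
          rw [integral_sub (integrable_of_continuous (by fun_prop))
            (integrable_of_continuous (by fun_prop)), hp, sub_zero]
          simp only [sq]
      _ ≤ ∫ y : S2, ε / (A + 1) * |D y| ∂sphereMeasure := by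
          refine integral_mono (integrable_of_continuous (by fun_prop))
            (integrable_of_continuous (by fun_prop)) fun y => ?_
          simp only
          refine (le_abs_self _).trans ?_
          rw [abs_mul, mul_comm, abs_sub_comm]
          exact mul_le_mul_of_nonneg_right (hpd _ (inner_mem_Icc x y)).le (abs_nonneg _)
      _ = ε / (A + 1) * A := integral_const_mul _ _
      _ ≤ 0 + ε := by
          rw [zero_add, div_mul_eq_mul_div, div_le_iff₀ (by positivity)]
          nlinarith
  have hae : (fun y => D y ^ 2) =ᵐ[sphereMeasure] 0 :=
    (integral_eq_zero_iff_of_nonneg (fun _ => sq_nonneg _)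
      (integrable_of_continuous (hDc.pow 2))).mp hsq
  have := congrFun ((Continuous.ae_eq_iff_eq sphereMeasure (hDc.pow 2) continuous_const).mp hae) y
  exact pow_eq_zero_iff two_ne_zero |>.mp this

/-- The spectral expansion of the covariance of an isotropic field. -/
lemma IsIsotropicGaussianField.hasSum_covarianceKernel (hT : IsIsotropicGaussianField T P)
    (hm : Measurable fun p : Ω × S2 => T p.2 p.1) (x y : S2) :
    HasSum (fun l => frequencyVariance T P l * zonal l x y)
      (covarianceKernel T P (inner ℝ (x : E3) (y : E3))) := by
  have hκ := hT.continuous_covarianceKernel hm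
  have hsum := hT.summable_frequencyVariance hm
  have hb : ∀ l, ∀ t ∈ Set.Icc (-1 : ℝ) 1,
      ‖frequencyVariance T P l * (legendreQ l).eval t‖ ≤ frequencyVariance T P l := by
    intro l t ht
    rw [norm_mul, Real.norm_of_nonneg (frequencyVariance_nonneg T P l)]
    exact mul_le_of_le_one_right (frequencyVariance_nonneg T P l) (abs_eval_legendreQ_le ht l)
  have hzb : ∀ l (u v : S2), ‖frequencyVariance T P l * zonal l u v‖ ≤ frequencyVariance T P l :=
    fun l u v => hb l _ (inner_mem_Icc u v)
  have hs : ∀ u v, Summable fun l => frequencyVariance T P l * zonal l u v := fun u v =>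
    Summable.of_norm_bounded hsum fun l => hzb l u v
  -- Only on [-1, 1] are the Legendre polynomials bounded by 1, so the series is controlled there
  -- and continuity is claimed nowhere else.
  have hd : ContinuousOn (fun t => covarianceKernel T P t -
      ∑' l, frequencyVariance T P l * (legendreQ l).eval t) (Set.Icc (-1) 1) :=
    hκ.continuousOn.sub (continuousOn_tsum (fun l => by fun_prop) hsum hb)
  have h0 := eq_zero_of_integral_mul_zonal hd x (fun k => ?_) y
  · rw [sub_eq_zero.mp h0]
    exact (hs x y).hasSum
  · have hF : ∀ l, Integrable (fun u : S2 => frequencyVariance T P l * zonal l x u * zonal k x u)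
        sphereMeasure := fun l => integrable_of_continuous (by fun_prop)
    have hFb : ∀ l (u : S2), ‖frequencyVariance T P l * zonal l x u * zonal k x u‖ ≤
        frequencyVariance T P l := fun l u => by
      rw [norm_mul]
      exact (mul_le_of_le_one_right (norm_nonneg _) (abs_zonal_le_one k x u)).trans (hzb l x u)
    have hFs : Summable fun l => ∫ u : S2, ‖frequencyVariance T P l * zonal l x u * zonal k x u‖
        ∂sphereMeasure := by
      refine Summable.of_nonneg_of_le (fun l => integral_nonneg fun _ => norm_nonneg _) (fun l => ?_)
        (hsum.mul_right (sphereMeasure.real Set.univ))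
      refine (integral_mono (hF l).norm (integrable_const _) (hFb l)).trans ?_
      simp [mul_comm]
    have hI := hasSum_integral_of_summable_integral_norm hF hFs
    have hk : ∀ l, ∫ u : S2, frequencyVariance T P l * zonal l x u * zonal k x u ∂sphereMeasure =
        if l = k then angularPowerSpectrum T P k else 0 := by
      intro l
      simp only [mul_assoc, zonal_comm k x, integral_const_mul, integral_zonal_mul_zonal]
      split_ifs with h
      · rw [h, zonal_self, frequencyVariance]
        field_simp
      · simp
    simp only [hk] at hI
    have hI2 := hI.unique (hasSum_ite_eq k (angularPowerSpectrum T P k))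
    simp only [tsum_mul_right] at hI2
    have hIn : Integrable (fun u : S2 => (∑' l, frequencyVariance T P l * zonal l x u) * zonal k x u)
        sphereMeasure := by
      refine integrable_of_continuous (Continuous.mul ?_ (by fun_prop))
      exact continuous_tsum (fun l => by fun_prop) hsum fun l u => hzb l x u
    have h1 := hT.integral_kernel_mul_zonal_self hm k x x
    rw [zonal_self, mul_one] at h1
    simp only [sub_mul]
    have hIk : Integrable (fun u : S2 => covarianceKernel T P (inner ℝ (x : E3) (u : E3)) *
        zonal k x u) sphereMeasure := integrable_of_continuous (by fun_prop)
    refine (integral_sub hIk hIn).trans ?_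
    rw [h1, hI2, sub_self]

end Spectrum

/-! ### Integrating the covariance against the laws of the two positions. -/

section SubordinateBrownianMotion

variable {Ω : Type*} [MeasurableSpace Ω] {P : Measure Ω} {Ψ : ℝ → ℝ} {BΨ : S2 → ℝ≥0 → Ω → S2}

lemma IsSubordinateRotationalBMFamily.measurable (hB : IsSubordinateRotationalBMFamily BΨ Ψ P)
    (x : S2) (t : ℝ≥0) : Measurable (BΨ x t) := by
  obtain ⟨B, D, hBM, hD, -, -, h⟩ := hB x
  rw [h]
  exact (measurable_uncurry_of_continuous_of_measurable (u := B) hBM.continuous_paths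
    hBM.measurable).comp ((hD.measurable t).prodMk measurable_id)

lemma IsSubordinateRotationalBMFamily.start (hB : IsSubordinateRotationalBMFamily BΨ Ψ P)
    (x : S2) : BΨ x 0 =ᵐ[P] fun _ => x := by
  obtain ⟨B, D, hBM, hD, -, -, h⟩ := hB x
  filter_upwards [hBM.start, hD.start] with ω h1 h2
  rw [h, timeChange, h2, h1]

lemma IsSubordinateRotationalBMFamily.integral_zonal [IsProbabilityMeasure P]
    (hB : IsSubordinateRotationalBMFamily BΨ Ψ P) (l : ℕ) (x v : S2) (t : ℝ≥0) :
    ∫ ω, zonal l (BΨ x t ω) v ∂P = Real.exp (-t * Ψ (sphereEigenvalue l)) * zonal l x v := by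
  obtain ⟨B, D, hBM, hD, hΨ, hBD, h⟩ := hB x
  rw [h]
  exact integral_zonal_timeChange hBM hD hΨ hBD l v t

lemma IsSubordinateRotationalBMFamily.exponent_nonneg [IsProbabilityMeasure P]
    (hB : IsSubordinateRotationalBMFamily BΨ Ψ P) {μ : ℝ} (hμ : 0 ≤ μ) : 0 ≤ Ψ μ := by
  obtain ⟨B, D, -, hD, hΨ, -, -⟩ := hB northPole
  have h := hΨ 1 μ hμ
  have hle : ∀ ω, Real.exp (-μ * D 1 ω) ≤ 1 := fun ω => by
    rw [Real.exp_le_one_iff, neg_mul, neg_nonpos]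
    positivity
  have hint : Integrable (fun ω => Real.exp (-μ * D 1 ω)) P := by
    refine Integrable.of_bound ?_ 1 (.of_forall fun ω => ?_)
    · have := hD.measurable 1
      exact (by fun_prop : Measurable fun ω => Real.exp (-μ * D 1 ω)).aestronglyMeasurable
    · rw [Real.norm_of_nonneg (Real.exp_pos _).le]
      exact hle ω
  have h1 := integral_mono hint (integrable_const 1) hle
  rw [h] at h1
  simpa using h1

/-- At time zero, which the hypothesis leaves out, the position is almost surely constant and so
independent of everything. -/
lemma IsSubordinateRotationalBMFamily.indepFun [IsProbabilityMeasure P]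
    (hB : IsSubordinateRotationalBMFamily BΨ Ψ P)
    (hBB : ∀ x y : S2, x ≠ y → ∀ t₁ t₂ : ℝ≥0, 0 < t₁ → 0 < t₂ →
      IndepFun (BΨ x t₁) (BΨ y t₂) P) {x y : S2} (hxy : x ≠ y) (t₁ t₂ : ℝ≥0) :
    IndepFun (BΨ x t₁) (BΨ y t₂) P := by
  rcases eq_zero_or_pos t₁ with rfl | h₁
  · exact (indepFun_const_left x _).congr (hB.start x).symm (ae_eq_refl _)
  rcases eq_zero_or_pos t₂ with rfl | h₂
  · exact (indepFun_const_right _ y).congr (ae_eq_refl _) (hB.start y).symm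
  exact hBB x y hxy t₁ t₂ h₁ h₂

/-- Integrating out the first point leaves a multiple of a zonal function of the second, so the
one-point formula applies again. -/
lemma IsSubordinateRotationalBMFamily.integral_zonal_prod [IsProbabilityMeasure P]
    (hB : IsSubordinateRotationalBMFamily BΨ Ψ P) (l : ℕ) (x y : S2) (t₁ t₂ : ℝ≥0) :
    ∫ z, zonal l z.1 z.2 ∂((P.map (BΨ x t₁)).prod (P.map (BΨ y t₂))) =
      Real.exp (-((t₁ : ℝ) + t₂) * Ψ (sphereEigenvalue l)) * zonal l x y := by
  have hx := (hB.measurable x t₁).aemeasurable (μ := P)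
  have hy := (hB.measurable y t₂).aemeasurable (μ := P)
  have := Measure.isProbabilityMeasure_map hx
  have := Measure.isProbabilityMeasure_map hy
  rw [integral_prod_symm _ ((continuous_zonal l).integrable_of_hasCompactSupport
    (HasCompactSupport.of_compactSpace _))]
  have h1 : ∀ v, ∫ u, zonal l u v ∂(P.map (BΨ x t₁)) =
      Real.exp (-t₁ * Ψ (sphereEigenvalue l)) * zonal l x v := fun v => by
    rw [integral_map hx (continuous_zonal_left l v).aestronglyMeasurable, hB.integral_zonal]
  simp only [h1, integral_const_mul]
  rw [integral_map hy (continuous_zonal_right l x).aestronglyMeasurable]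
  simp only [zonal_comm l x, hB.integral_zonal]
  rw [← mul_assoc, ← Real.exp_add]
  congr 2
  ring

lemma abs_frequencyCovariance_le (T : S2 → Ω → ℝ) (P : Measure Ω) (x y : S2) (l : ℕ) :
    |frequencyCovariance T P x y l| ≤ frequencyVariance T P l := by
  rw [frequencyCovariance_eq, abs_mul, abs_of_nonneg (frequencyVariance_nonneg T P l)]
  exact mul_le_of_le_one_right (frequencyVariance_nonneg T P l) (abs_zonal_le_one l x y)

/-- Integration of the covariance function against the laws of two independent subordinate
rotational Brownian motions. -/
lemma hasSum_integral_covarianceKernel [IsProbabilityMeasure P] {T : S2 → Ω → ℝ}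
    (hT : IsIsotropicGaussianField T P) (hm : Measurable fun p : Ω × S2 => T p.2 p.1)
    (hB : IsSubordinateRotationalBMFamily BΨ Ψ P) (x y : S2) (t₁ t₂ : ℝ≥0) :
    HasSum (fun l : ℕ => frequencyCovariance T P x y l *
        Real.exp (-((t₁ : ℝ) + t₂) * Ψ (sphereEigenvalue l)))
      (∫ z, covarianceKernel T P (inner ℝ (z.1 : E3) (z.2 : E3))
        ∂((P.map (BΨ x t₁)).prod (P.map (BΨ y t₂)))) := by
  have := Measure.isProbabilityMeasure_map ((hB.measurable x t₁).aemeasurable (μ := P))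
  have := Measure.isProbabilityMeasure_map ((hB.measurable y t₂).aemeasurable (μ := P))
  have hF : ∀ l, Integrable (fun z : S2 × S2 => frequencyVariance T P l * zonal l z.1 z.2)
      ((P.map (BΨ x t₁)).prod (P.map (BΨ y t₂))) := fun l =>
    ((continuous_zonal l).integrable_of_hasCompactSupport
      (HasCompactSupport.of_compactSpace _)).const_mul _
  have hFs : Summable fun l => ∫ z : S2 × S2, ‖frequencyVariance T P l * zonal l z.1 z.2‖
      ∂((P.map (BΨ x t₁)).prod (P.map (BΨ y t₂))) := by
    refine Summable.of_nonneg_of_le (fun l => integral_nonneg fun _ => norm_nonneg _) (fun l => ?_)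
      (hT.summable_frequencyVariance hm)
    refine (integral_mono (hF l).norm (integrable_const (frequencyVariance T P l))
      fun z => abs_frequencyCovariance_le T P z.1 z.2 l).trans ?_
    simp
  have hI := hasSum_integral_of_summable_integral_norm hF hFs
  simp only [(hT.hasSum_covarianceKernel hm _ _).tsum_eq, integral_const_mul,
    hB.integral_zonal_prod] at hI
  have e : ∀ l, frequencyVariance T P l *
      (Real.exp (-((t₁ : ℝ) + t₂) * Ψ (sphereEigenvalue l)) * zonal l x y) =
      frequencyCovariance T P x y l * Real.exp (-((t₁ : ℝ) + t₂) * Ψ (sphereEigenvalue l)) :=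
    fun l => by rw [frequencyCovariance_eq]; ring
  simpa only [e] using hI

lemma tendsto_exp_neg_add_mul {ψ : ℝ} (hψ : 0 ≤ ψ) :
    Tendsto (fun t : ℝ≥0 × ℝ≥0 => Real.exp (-((t.1 : ℝ) + t.2) * ψ))
      (comap (fun t : ℝ≥0 × ℝ≥0 => t.1 + t.2) atTop) (𝓝 (if ψ = 0 then 1 else 0)) := by
  split_ifs with h
  · simpa [h] using tendsto_const_nhds
  · have h1 : Tendsto (fun t : ℝ≥0 × ℝ≥0 => (t.1 : ℝ) + t.2)
        (comap (fun t : ℝ≥0 × ℝ≥0 => t.1 + t.2) atTop) atTop := by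
      have := NNReal.tendsto_coe_atTop.mpr (tendsto_comap (f := fun t : ℝ≥0 × ℝ≥0 => t.1 + t.2)
        (x := atTop))
      simpa using this
    refine Real.tendsto_exp_atBot.comp ?_
    simp only [neg_mul]
    exact tendsto_neg_atTop_atBot.comp (h1.atTop_mul_const (hψ.lt_of_ne' h))

end SubordinateBrownianMotion

/-! ### Freezing the two positions, and the theorem. -/

lemma integral_field_comp {Ω : Type*} {𝓖 : MeasurableSpace Ω} [mΩ : MeasurableSpace Ω]
    {P : Measure Ω} [IsProbabilityMeasure P] {T : S2 → Ω → ℝ} (hT : IsIsotropicGaussianField T P)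
    (h𝓖 : 𝓖 ≤ mΩ) (hTmeas : Measurable[𝓖.prod inferInstance] (fun p : Ω × S2 => T p.2 p.1))
    {U V : Ω → S2} (hU : Measurable U) (hV : Measurable V)
    (hind : Indep 𝓖 (MeasurableSpace.comap (fun ω => (U ω, V ω)) inferInstance) P)
    (hUV : IndepFun U V P) :
    Integrable (fun ω => T (U ω) ω * T (V ω) ω) P ∧
      ∫ ω, T (U ω) ω * T (V ω) ω ∂P =
        ∫ z, covarianceKernel T P (inner ℝ (z.1 : E3) (z.2 : E3)) ∂((P.map U).prod (P.map V)) := by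
  obtain ⟨h1, h2⟩ := integrable_and_integral_comp_of_indep h𝓖 (hU.prodMk hV) hind
    (@measurable_field_mul Ω 𝓖 T hTmeas) (fun z => hT.integrable_mul z.1 z.2)
    (fun z => hT.integral_abs_mul_le z.1 z.2)
  refine ⟨h1, h2.trans ?_⟩
  rw [(indepFun_iff_map_prod_eq_prod_map_map hU.aemeasurable hV.aemeasurable).mp hUV]
  refine integral_congr_ae (.of_forall fun z => ?_)
  exact hT.fieldCovariance_eq_kernel z.1 z.2

theorem theorem1 {Ω : Type*} (𝓕T : MeasurableSpace Ω) [mΩ : MeasurableSpace Ω]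
    (P : Measure Ω) [IsProbabilityMeasure P]
    -- the zero-mean isotropic Gaussian field, jointly measurable over a sub-σ-field `𝓕T`
    (T : S2 → Ω → ℝ) (hT : IsIsotropicGaussianField T P)
    (h𝓕T : 𝓕T ≤ mΩ)
    (hTmeas : Measurable[𝓕T.prod inferInstance] (fun p : Ω × S2 => T p.2 p.1))
    -- the subordinate rotational Brownian motions, one for each starting point
    (Ψ : ℝ → ℝ) (BΨ : S2 → ℝ≥0 → Ω → S2) (hB : IsSubordinateRotationalBMFamily BΨ Ψ P)
    -- the field is independent of the Brownian motions
    (hTB : Indep 𝓕T (⨆ x, ⨆ t, MeasurableSpace.comap (BΨ x t) inferInstance) P)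
    -- distinct starting points give independent processes
    (hBB : ∀ x y : S2, x ≠ y → ∀ t₁ t₂ : ℝ≥0, 0 < t₁ → 0 < t₂ →
      IndepFun (BΨ x t₁) (BΨ y t₂) P)
    (x y : S2) (hxy : x ≠ y) :
    -- finite times
    (∀ t₁ t₂ : ℝ≥0,
      Integrable (fun ω => coordinateChangedField T BΨ t₁ x ω *
        coordinateChangedField T BΨ t₂ y ω) P ∧
      HasSum (fun l : ℕ => frequencyCovariance T P x y l *
          Real.exp (-((t₁ : ℝ) + t₂) * Ψ (sphereEigenvalue l)))
        (∫ ω, coordinateChangedField T BΨ t₁ x ω * coordinateChangedField T BΨ t₂ y ω ∂P)) ∧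
    -- infinite times, as limits: `exp (-∞ · Ψ)` is `1` where `Ψ = 0`, and `0` elsewhere
    (∃ S : ℝ,
      HasSum (fun l : ℕ => frequencyCovariance T P x y l *
        Set.indicator {μ : ℝ | Ψ μ = 0} 1 (sphereEigenvalue l)) S ∧
      Tendsto (fun t : ℝ≥0 × ℝ≥0 => ∫ ω, coordinateChangedField T BΨ t.1 x ω *
          coordinateChangedField T BΨ t.2 y ω ∂P)
        (comap (fun t : ℝ≥0 × ℝ≥0 => t.1 + t.2) atTop) (𝓝 S)) := by
  have hm : Measurable fun p : Ω × S2 => T p.2 p.1 :=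
    hTmeas.mono (sup_le_sup_right (MeasurableSpace.comap_mono h𝓕T) _) le_rfl
  have hpair : ∀ t₁ t₂ : ℝ≥0, Indep 𝓕T
      (MeasurableSpace.comap (fun ω => (BΨ x t₁ ω, BΨ y t₂ ω)) inferInstance) P := fun t₁ t₂ => by
    refine indep_of_indep_of_le_right hTB ?_
    refine (MeasurableSpace.comap_prodMk (BΨ x t₁) (BΨ y t₂)).trans_le ?_
    exact sup_le (le_iSup₂_of_le x t₁ le_rfl) (le_iSup₂_of_le y t₂ le_rfl)
  have hkey := fun t₁ t₂ : ℝ≥0 => integral_field_comp hT h𝓕T hTmeas (hB.measurable x t₁)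
    (hB.measurable y t₂) (hpair t₁ t₂) (hB.indepFun hBB hxy t₁ t₂)
  have hfin : ∀ t₁ t₂ : ℝ≥0, HasSum (fun l : ℕ => frequencyCovariance T P x y l *
      Real.exp (-((t₁ : ℝ) + t₂) * Ψ (sphereEigenvalue l)))
      (∫ ω, coordinateChangedField T BΨ t₁ x ω * coordinateChangedField T BΨ t₂ y ω ∂P) := by
    intro t₁ t₂
    have := hasSum_integral_covarianceKernel hT hm hB x y t₁ t₂
    rwa [← (hkey t₁ t₂).2] at this
  have hμ : ∀ l, 0 ≤ sphereEigenvalue l := fun l => by unfold sphereEigenvalue; positivity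
  have hsum := hT.summable_frequencyVariance hm
  have hind : ∀ l, Set.indicator {μ : ℝ | Ψ μ = 0} 1 (sphereEigenvalue l) =
      if Ψ (sphereEigenvalue l) = 0 then (1 : ℝ) else 0 := fun l => by
    simp [Set.indicator_apply]
  refine ⟨fun t₁ t₂ => ⟨(hkey t₁ t₂).1, hfin t₁ t₂⟩, _, Summable.hasSum ?_, ?_⟩
  · refine Summable.of_norm_bounded hsum fun l => ?_
    rw [hind, norm_mul]
    refine (mul_le_of_le_one_right (norm_nonneg _) ?_).trans (abs_frequencyCovariance_le T P x y l)
    split_ifs <;> simp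
  · simp only [← fun t₁ t₂ => (hfin t₁ t₂).tsum_eq]
    -- Since Ψ(μ_l) ≥ 0 the exponentials are at most 1, so the variances dominate the series
    -- uniformly in time.
    refine tendsto_tsum_of_dominated_convergence hsum (fun l => ?_) (.of_forall fun t l => ?_)
    · rw [hind]
      exact (tendsto_exp_neg_add_mul (hB.exponent_nonneg (hμ l))).const_mul _
    · rw [norm_mul]
      refine (mul_le_of_le_one_right (norm_nonneg _) ?_).trans
        (abs_frequencyCovariance_le T P x y l)
      rw [Real.norm_of_nonneg (Real.exp_pos _).le, Real.exp_le_one_iff, neg_mul, neg_nonpos]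
      exact mul_nonneg (by positivity) (hB.exponent_nonneg (hμ l))
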